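/- There is an absolute constant $C>0$ such that for every real $\alpha>1$ and every integer $n\ge 0$ there is a non-empty set $X\subseteq S_n$ of permutations of $[n]=\{1,\dots,n\}$ with $$|X|\le \exp\Big(C\,\frac n\alpha\,(1+\log^2\alpha)\Big)$$ such that the uniform distribution $\mathcal U(X)$ on $X$ is backwards $\alpha$-uniform. Here a distribution $\mathcal D$ on $S_n$ is called backwards $\alpha$-uniform if for every $Y\subseteq[n]$ with $\Pr_{\pi\sim\mathcal D}[\pi(\{1,\dots,|Y|\})=Y]>0$ and every $x\in Y$, $$\Pr_{\pi\sim\mathcal D}\big[\pi(|Y|)=x \,\big|\, \pi(\{1,\dots,|Y|\})=Y\big]\le \frac{\alpha}{|Y|}.$$ -/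

import Mathlib

/-!
Read backwards, `π` is a random list, and the condition says that given the set `R` of the first
`k` entries, each element comes next with probability at most `α / (n - k)`.

The heart of the proof is a random `h`-subset of `2 ^ d * h` points, the survivors, together with a
seed that, given the survivors, orders the other points so that each comes next with probability
`O(1 / h)`. Two such schemes on disjoint ground sets are merged using the *same* seed but
independent survivors: list both, pool the `2 * h` survivors and list a random half of them. The
conditional law of the choices made, given the new survivors, is rounded to `M` equiprobable values,
so that `d` levels cost only `M ^ d` seeds. The rounding is harmless as soon as no weight is tiny,
which follows from a spread condition: each set `A` survives with probability at least `q ^ #A`.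
This allows `M = 2 ^ O(h * L)` for all `d ≤ L`.

With `h ≈ 4 * n / α` and `L ≈ log α` this lists a constant fraction of `[n]` in `2 ^ O(h * L ^ 2)`
ways, and the rest is listed recursively. The recursive family is translated by a different
permutation for each initial list, chosen so that no two lists of the rest coincide: given which
elements remain, the rest then determines the initial list. For bounded `α`, splitting into halves
repeatedly gives at most `16 ^ n` lists whose next element is always uniform.
-/

open Finset

/-- The set `π([m]) = {π(1), …, π(m)}` of the first `m` elements of the permutation `π`.
Positions and elements are indexed by `Fin n`, so the position called `i` in `1, …, n` is
the element of `Fin n` with value `i - 1`. -/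
def prefixSet {n : ℕ} (π : Equiv.Perm (Fin n)) (m : ℕ) : Finset (Fin n) :=
  (univ.filter fun j : Fin n => (j : ℕ) < m).image π

/-- The probability `Pr_{π ∼ D}[E]` of an event `E`. -/
noncomputable def prob {n : ℕ} (D : PMF (Equiv.Perm (Fin n)))
    (E : Set (Equiv.Perm (Fin n))) : ENNReal :=
  D.toOuterMeasure E

/-- The conditional probability `Pr_{π ∼ D}[E | F]`, used only when `F` has positive
probability. -/
noncomputable def condProb {n : ℕ} (D : PMF (Equiv.Perm (Fin n)))
    (E F : Set (Equiv.Perm (Fin n))) : ENNReal :=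
  prob D (E ∩ F) / prob D F

/-- `D` is backwards `α`-uniform: for every set `Y` with `Pr[π([|Y|]) = Y] > 0` and every
`x ∈ Y`, `Pr[π(|Y|) = x | π([|Y|]) = Y] ≤ α / |Y|`. The index `i` with `i + 1 = |Y|` is the
position `|Y|`; it exists and is unique whenever `Y` is nonempty. -/
def BackwardsUniform {n : ℕ} (D : PMF (Equiv.Perm (Fin n))) (α : ℝ) : Prop :=
  ∀ Y : Finset (Fin n), 0 < prob D {π | prefixSet π #Y = Y} →
    ∀ x ∈ Y, ∀ i : Fin n, (i : ℕ) + 1 = #Y →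
      condProb D {π | π i = x} {π | prefixSet π #Y = Y} ≤ ENNReal.ofReal (α / (#Y : ℝ))

open scoped NNReal

/-- The list `l` lists the elements of `S`, each exactly once. -/
def Enumerates {V : Type*} (l : List V) (S : Finset V) : Prop :=
  (l : Multiset V) = S.val

/-- The list `l` first lists the elements of `R`, in any order, and continues with `x`. -/
def ListsThen {V : Type*} (l : List V) (R : Finset V) (x : V) : Prop :=
  Enumerates (l.take #R) R ∧ l[#R]? = some x

/-- The list `l` first lists the elements of `R`, in any order, and does not end there. -/
def ListsFirst {V : Type*} (l : List V) (R : Finset V) : Prop :=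
  ∃ x, ListsThen l R x

section Lists

variable {V W : Type*} {l a b : List V} {R S : Finset V} {x y : V}

namespace Enumerates

theorem mem_iff (h : Enumerates l S) : x ∈ l ↔ x ∈ S := by
  rw [← Multiset.mem_coe, h, mem_val]

theorem length_eq (h : Enumerates l S) : l.length = #S :=
  congrArg Multiset.card h

theorem nodup (h : Enumerates l S) : l.Nodup := by
  rw [← Multiset.coe_nodup, h]
  exact S.nodup

theorem map (h : Enumerates l S) (e : V ↪ W) : Enumerates (l.map e) (S.map e) := by
  rw [Enumerates, ← Multiset.map_coe, h, map_val]

theorem append_disjSum {b : List W} {T : Finset W} (ha : Enumerates a S) (hb : Enumerates b T) :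
    Enumerates (a.map Sum.inl ++ b.map Sum.inr) (S.disjSum T) := by
  rw [Enumerates, ← Multiset.coe_add, ← Multiset.map_coe, ← Multiset.map_coe, ha, hb]
  rfl

theorem append_disjUnion (ha : Enumerates a S) (hb : Enumerates b R) (hd : Disjoint S R) :
    Enumerates (a ++ b) (S.disjUnion R hd) := by
  rw [Enumerates, ← Multiset.coe_add, ha, hb, disjUnion_val]

theorem exists_eq_map {W : Type*} {T : Finset W} {e : V ↪ W} (h : Enumerates (l.map e) T) :
    ∃ S, Enumerates l S ∧ S.map e = T := by
  have hl : Enumerates l ⟨l, Multiset.coe_nodup.2 h.nodup.of_map⟩ := rfl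
  exact ⟨_, hl, val_injective ((hl.map e).symm.trans h)⟩

end Enumerates

theorem ListsThen.listsFirst (h : ListsThen l R x) : ListsFirst l R :=
  ⟨x, h⟩

theorem ListsThen.unique (hx : ListsThen l R x) (hy : ListsThen l R y) : x = y :=
  Option.some_injective _ (hx.2.symm.trans hy.2)

theorem ListsThen.coe_take_card_add_one (h : ListsThen l R x) :
    ((l.take (#R + 1) : List V) : Multiset V) = x ::ₘ R.val := by
  rw [List.take_add_one, h.2, ← h.1, ← Multiset.singleton_add, add_comm]
  rfl

theorem ListsThen.notMem (h : ListsThen l R x) (hl : l.Nodup) : x ∉ R := by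
  have hnd : (x ::ₘ R.val).Nodup :=
    h.coe_take_card_add_one ▸ Multiset.coe_nodup.2 (hl.sublist (List.take_sublist _ _))
  exact (Multiset.nodup_cons.1 hnd).1

theorem ListsThen.insert_subset [DecidableEq V] (h : ListsThen l R x) (hl : Enumerates l S) :
    insert x R ⊆ S := by
  intro y hy
  have hy' : y ∈ x ::ₘ R.val := by simpa using hy
  rw [← h.coe_take_card_add_one] at hy'
  exact hl.mem_iff.1 (List.mem_of_mem_take hy')

theorem ListsFirst.length_lt (h : ListsFirst l R) : #R < l.length :=
  (List.getElem?_eq_some_iff.1 h.choose_spec.2).1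

theorem listsThen_append_left (h : #R < a.length) :
    ListsThen (a ++ b) R x ↔ ListsThen a R x := by
  rw [ListsThen, ListsThen, List.take_append_of_le_length h.le, List.getElem?_append_left h]

theorem listsFirst_append_left (h : #R < a.length) :
    ListsFirst (a ++ b) R ↔ ListsFirst a R :=
  exists_congr fun _ => listsThen_append_left h

theorem listsThen_append_right [DecidableEq V] (ha : Enumerates a S) (h : #S ≤ #R) :
    ListsThen (a ++ b) R x ↔ S ⊆ R ∧ ListsThen b (R \ S) x := by
  have hlen : a.length ≤ #R := ha.length_eq ▸ h
  have hprefix (hSR : S ⊆ R) (c : List V) : Enumerates (a ++ c) R ↔ Enumerates c (R \ S) := by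
    rw [Enumerates, Enumerates, ← Multiset.coe_add, ha, ← val_le_iff.2 hSR |> add_tsub_cancel_of_le,
      add_right_inj, sdiff_val]
  have hsub (c : List V) (hc : Enumerates (a ++ c) R) : S ⊆ R := fun y hy =>
    hc.mem_iff.1 (List.mem_append_left _ (ha.mem_iff.2 hy))
  rw [ListsThen, List.take_append, List.take_of_length_le hlen, List.getElem?_append_right hlen,
    ha.length_eq]
  constructor
  · rintro ⟨hR, hx⟩
    have hSR := hsub _ hR
    rw [← card_sdiff_of_subset hSR] at hR hx
    exact ⟨hSR, (hprefix hSR _).1 hR, hx⟩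
  · rintro ⟨hSR, hR, hx⟩
    rw [← card_sdiff_of_subset hSR]
    exact ⟨(hprefix hSR _).2 hR, hx⟩

theorem listsFirst_append_right [DecidableEq V] (ha : Enumerates a S) (h : #S ≤ #R) :
    ListsFirst (a ++ b) R ↔ S ⊆ R ∧ ListsFirst b (R \ S) := by
  simp only [ListsFirst, listsThen_append_right ha h, exists_and_left]

theorem listsThen_map_iff {e : V ↪ W} {R : Finset W} {x : W} :
    ListsThen (l.map e) R x ↔ ∃ R' x', R'.map e = R ∧ e x' = x ∧ ListsThen l R' x' := by
  constructor
  · rintro ⟨hR, hx⟩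
    rw [← List.map_take] at hR
    obtain ⟨R', hR', rfl⟩ := hR.exists_eq_map
    rw [card_map] at hR' hx
    rw [List.getElem?_map, Option.map_eq_some_iff] at hx
    obtain ⟨x', hx', rfl⟩ := hx
    exact ⟨R', x', rfl, rfl, hR', hx'⟩
  · rintro ⟨R', x', rfl, rfl, hR', hx'⟩
    rw [ListsThen, card_map, ← List.map_take, List.getElem?_map, hx']
    exact ⟨hR'.map e, rfl⟩

theorem listsThen_map {e : V ↪ W} : ListsThen (l.map e) (R.map e) (e x) ↔ ListsThen l R x := by
  simp only [listsThen_map_iff, (Finset.map_injective e).eq_iff, e.injective.eq_iff,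
    exists_and_left, exists_eq_left]

theorem listsFirst_map {e : V ↪ W} : ListsFirst (l.map e) (R.map e) ↔ ListsFirst l R := by
  refine ⟨fun ⟨_, h⟩ => ?_, fun ⟨x, h⟩ => ⟨e x, listsThen_map.2 h⟩⟩
  obtain ⟨_, x, hR, -, hx⟩ := listsThen_map_iff.1 h
  rw [Finset.map_injective e hR] at hx
  exact ⟨x, hx⟩

end Lists

/-- The total weight of the event `E` under the weights `w`. -/
noncomputable def mass {Ω : Type*} [Fintype Ω] (w : Ω → ℝ≥0) (E : Set Ω) : ℝ≥0 :=
  ∑ ω, E.indicator w ω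

/-- The weights induced by `w` on the values of `g`. -/
noncomputable def pushforward {Ω J : Type*} [Fintype Ω] (g : Ω → J) (w : Ω → ℝ≥0) : J → ℝ≥0 :=
  fun j => mass w (g ⁻¹' {j})

/-- The weights `w` and `w'` agree pointwise up to the factor `r`. -/
def WithinFactor {Ω : Type*} (r : ℝ≥0) (w w' : Ω → ℝ≥0) : Prop :=
  w ≤ r • w' ∧ w' ≤ r • w

section Mass

variable {Ω Ω' J : Type*} [Fintype Ω] [Fintype Ω'] [Fintype J] {w w' : Ω → ℝ≥0} {E F : Set Ω}
  {r : ℝ≥0}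

theorem mass_le_mass (hw : w ≤ w') (hE : E ⊆ F) : mass w E ≤ mass w' F :=
  sum_le_sum fun ω _ => (Set.indicator_le_indicator_of_subset hE (fun _ => zero_le) ω).trans
    (Set.indicator_le_indicator (hw ω))

theorem mass_mono (hE : E ⊆ F) : mass w E ≤ mass w F :=
  mass_le_mass le_rfl hE

theorem mass_le_sum : mass w E ≤ ∑ ω, w ω :=
  sum_le_sum fun _ _ => Set.indicator_le_self' (fun _ _ => zero_le) _

theorem mass_eq_zero (h : ∀ ω, ω ∉ E) : mass w E = 0 :=
  sum_eq_zero fun ω _ => Set.indicator_of_notMem (h ω) w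

theorem mass_smul : mass (r • w) E = r * mass w E := by
  rw [mass, mass, mul_sum]
  exact sum_congr rfl fun ω _ => Set.indicator_const_smul_apply E r w ω

theorem mass_one_eq_card [DecidablePred (· ∈ E)] : mass 1 E = #{ω | ω ∈ E} := by
  simp [mass, Set.indicator_apply]

theorem mass_eq_sum_fibers (e : Ω × Ω' ≃ J) (v : J → ℝ≥0) (G : Set J) :
    mass v G = ∑ ω, mass (fun ω' => v (e (ω, ω'))) {ω' | e (ω, ω') ∈ G} :=
  (e.sum_comp _).symm.trans (Fintype.sum_prod_type _)

theorem mass_pushforward (g : Ω → J) (F : Set J) :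
    mass (pushforward g w) F = mass w (g ⁻¹' F) := by
  classical
  simp only [mass, pushforward, Set.indicator_apply, Set.mem_preimage, Set.mem_singleton_iff]
  rw [← sum_filter, sum_comm]
  refine sum_congr rfl fun ω _ => ?_
  simp

theorem sum_pushforward (g : Ω → J) : ∑ j, pushforward g w j = ∑ ω, w ω := by
  have h := mass_pushforward (w := w) g Set.univ
  simpa only [mass, Set.preimage_univ, Set.indicator_univ] using h

end Mass

/-- In the family of lists `l` with weights `w`, conditionally on the first `k` entries forming any
given set, each element comes next with probability at most `β`. -/
def HazardLE {Ω V : Type*} [Fintype Ω] (w : Ω → ℝ≥0) (l : Ω → List V) (k : ℕ) (β : ℝ≥0) : Prop :=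
  ∀ R : Finset V, #R = k → ∀ x,
    mass w {ω | ListsThen (l ω) R x} ≤ β * mass w {ω | ListsFirst (l ω) R}

namespace HazardLE

variable {Ω Ω' V W : Type*} [Fintype Ω] [Fintype Ω'] {w w' : Ω → ℝ≥0}
  {l a b : Ω → List V} {S : Finset V} {k : ℕ} {β β' r : ℝ≥0}

theorem of_one_le (hβ : 1 ≤ β) : HazardLE w l k β := fun _ _ _ =>
  (mass_mono fun _ h => h.listsFirst).trans (le_mul_of_one_le_left zero_le hβ)

theorem of_length_le (h : ∀ ω, (l ω).length ≤ k) : HazardLE w l k β := by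
  intro R hR x
  exact (mass_eq_zero fun ω hω => (hω.listsFirst.length_lt.trans_le (h ω)).ne hR).trans_le zero_le

theorem mono (h : HazardLE w l k β) (hβ : β ≤ β') : HazardLE w l k β' := fun R hR x =>
  (h R hR x).trans (mul_le_mul_left hβ _)

theorem smul (h : HazardLE w l k β) : HazardLE (r • w) l k β := by
  intro R hR x
  rw [mass_smul, mass_smul, mul_left_comm]
  exact mul_le_mul_right (h R hR x) r

theorem of_withinFactor (h : HazardLE w l k β) (hr : WithinFactor r w w') :
    HazardLE w' l k (β * r ^ 2) := by
  intro R hR x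
  have hmass {u v : Ω → ℝ≥0} (huv : u ≤ r • v) (E : Set Ω) : mass u E ≤ r * mass v E :=
    mass_smul (w := v) (r := r) ▸ mass_le_mass huv subset_rfl
  calc mass w' {ω | ListsThen (l ω) R x}
      ≤ r * mass w {ω | ListsThen (l ω) R x} := hmass hr.2 _
    _ ≤ r * (β * (r * mass w' {ω | ListsFirst (l ω) R})) := by
        gcongr
        exact (h R hR x).trans (mul_le_mul_right (hmass hr.1 _) β)
    _ = β * r ^ 2 * mass w' {ω | ListsFirst (l ω) R} := by ring

theorem of_fibers {A : Type*} [Finite A] (e : A × Ω ≃ Ω') {v : Ω' → ℝ≥0} {m : Ω' → List V}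
    (h : ∀ a, HazardLE (fun ω => v (e (a, ω))) (fun ω => m (e (a, ω))) k β) :
    HazardLE v m k β := by
  have := Fintype.ofFinite A
  intro R hR x
  rw [mass_eq_sum_fibers e, mass_eq_sum_fibers e, mul_sum]
  exact sum_le_sum fun a _ => h a R hR x

theorem pushforward_iff {g : Ω → Ω'} {m : Ω' → List V} :
    HazardLE (pushforward g w) m k β ↔ HazardLE w (m ∘ g) k β := by
  simp only [HazardLE, mass_pushforward, Set.preimage_ofPred_eq, Function.comp_apply]

theorem map (h : HazardLE w l k β) (e : V ↪ W) : HazardLE w (fun ω => (l ω).map e) k β := by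
  intro R hR x
  by_cases hRx : ∃ ω, ListsThen ((l ω).map e) R x
  · obtain ⟨ω, hω⟩ := hRx
    obtain ⟨R, x, rfl, rfl, -⟩ := listsThen_map_iff.1 hω
    simp only [listsThen_map, listsFirst_map]
    exact h R (by rwa [card_map] at hR) x
  · exact (mass_eq_zero fun ω hω => hRx ⟨ω, hω⟩).trans_le zero_le

theorem append_left (h : HazardLE w a k β) (hk : ∀ ω, k < (a ω).length) :
    HazardLE w (fun ω => a ω ++ b ω) k β := by
  rintro R rfl x
  simp only [listsThen_append_left (hk _), listsFirst_append_left (hk _)]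
  exact h R rfl x

theorem append_right (h : HazardLE w b (k - #S) β) (ha : ∀ ω, Enumerates (a ω) S) (hk : #S ≤ k) :
    HazardLE w (fun ω => a ω ++ b ω) k β := by
  classical
  rintro R rfl x
  simp only [listsThen_append_right (ha _) hk, listsFirst_append_right (ha _) hk]
  by_cases hSR : S ⊆ R
  · simpa only [hSR, true_and] using h (R \ S) (card_sdiff_of_subset hSR) x
  · exact (mass_eq_zero fun ω hω => hSR hω.1).trans_le zero_le

end HazardLE

section Subsets

variable {V : Type*} {m : ℕ}

/-- An enumeration of the `m`-element set `S`, which transports lists on `Fin m` to lists of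
elements of `S`. -/
noncomputable def enum (S : Set.powersetCard V m) : Fin m ↪ V :=
  (Set.powersetCard.ofFinEmb_surjective m V S).choose

theorem map_enum_univ (S : Set.powersetCard V m) : univ.map (enum S) = (S : Finset V) := by
  conv_rhs => rw [← (Set.powersetCard.ofFinEmb_surjective m V S).choose_spec]
  exact (Set.powersetCard.val_ofFinEmb m V _).symm

theorem exists_map_enum_eq {S : Set.powersetCard V m} {T : Finset V} (hT : T ⊆ S) :
    ∃ T' : Finset (Fin m), T'.map (enum S) = T := by
  rw [← map_enum_univ S] at hT
  obtain ⟨T', -, hT'⟩ := subset_map_iff.1 hT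
  exact ⟨T', hT'.symm⟩

theorem Enumerates.map_enum {l : List (Fin m)} (h : Enumerates l univ) (S : Set.powersetCard V m) :
    Enumerates (l.map (enum S)) S :=
  map_enum_univ S ▸ h.map (enum S)

variable [Fintype V]

theorem card_powersetCard_eq_choose :
    Fintype.card (Set.powersetCard V m) = (Fintype.card V).choose m := by
  rw [Fintype.card_eq_nat_card, Set.powersetCard.card, Nat.card_eq_fintype_card]

variable [DecidableEq V]

theorem card_powersetCard_filter_superset {T : Finset V} (hT : #T ≤ m) :
    #{S : Set.powersetCard V m | T ⊆ S} = (Fintype.card V - #T).choose (m - #T) := by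
  rw [← card_univ, ← card_filter_powersetCard_subset T univ m (subset_univ T) hT,
    ← card_map (Function.Embedding.subtype _)]
  congr 1
  ext S
  simp [Set.powersetCard.mem_iff, and_comm]

theorem card_powersetCard_filter_subset (T : Finset V) :
    #{S : Set.powersetCard V m | (S : Finset V) ⊆ T} = (#T).choose m := by
  rw [← card_powersetCard, ← card_map (Function.Embedding.subtype _)]
  congr 1
  ext S
  simp [Set.powersetCard.mem_iff, mem_powersetCard]

end Subsets

/-- At step `k` the uniformly random list in the family `l` is exactly uniform: every way of first
listing a `k`-element set and continuing with a further element occurs for `c` indices. -/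
def EquidistributedAt {Ω V : Type*} [Fintype Ω] (l : Ω → List V) (k : ℕ) (c : ℝ≥0) : Prop :=
  ∀ R : Finset V, #R = k → ∀ x ∉ R, mass 1 {ω | ListsThen (l ω) R x} = c

section Equidistributed

variable {Ω V : Type*} [Fintype Ω] {m k : ℕ} {c : ℝ≥0}

theorem mass_listsFirst [Fintype V] {w : Ω → ℝ≥0} {l : Ω → List V} (R : Finset V) :
    mass w {ω | ListsFirst (l ω) R} = ∑ x, mass w {ω | ListsThen (l ω) R x} := by
  classical
  simp only [mass]
  rw [sum_comm]
  refine sum_congr rfl fun ω _ => ?_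
  by_cases h : ListsFirst (l ω) R
  · obtain ⟨x, hx⟩ := h
    rw [Set.indicator_of_mem (s := {ω | ListsFirst (l ω) R}) hx.listsFirst,
      sum_eq_single_of_mem x (mem_univ x),
      Set.indicator_of_mem (s := {ω | ListsThen (l ω) R x}) hx]
    exact fun y _ hy => Set.indicator_of_notMem (fun h => hy (h.unique hx)) w
  · rw [Set.indicator_of_notMem (s := {ω | ListsFirst (l ω) R}) h]
    exact (sum_eq_zero fun x _ => Set.indicator_of_notMem (fun hx => h hx.listsFirst) w).symm

namespace EquidistributedAt

theorem hazardLE [Fintype V] {l : Ω → List V} (h : EquidistributedAt l k c)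
    (hl : ∀ ω, (l ω).Nodup) :
    HazardLE 1 l k ((Fintype.card V - k : ℕ) : ℝ≥0)⁻¹ := by
  classical
  intro R hR x
  by_cases hx : x ∈ R
  · exact (mass_eq_zero fun ω hω => hω.notMem (hl ω) hx).trans_le zero_le
  · have hpos : ((Fintype.card V - k : ℕ) : ℝ≥0) ≠ 0 := by
      rw [← hR, ← card_compl]
      exact Nat.cast_ne_zero.2 (card_pos.2 ⟨x, mem_compl.2 hx⟩).ne'
    have hfirst : (Fintype.card V - k : ℕ) * c ≤ mass 1 {ω | ListsFirst (l ω) R} := by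
      rw [mass_listsFirst, ← hR, ← card_compl, ← nsmul_eq_mul]
      calc #Rᶜ • c = ∑ y ∈ Rᶜ, mass 1 {ω | ListsThen (l ω) R y} :=
            (sum_eq_card_nsmul fun y hy => h R hR y (mem_compl.1 hy)).symm
        _ ≤ ∑ y, mass 1 {ω | ListsThen (l ω) R y} := sum_le_univ_sum_of_nonneg fun _ => zero_le
    rw [h R hR x hx, ← inv_mul_cancel_left₀ hpos c]
    gcongr

theorem mass_listsThen_map_enum {l : Ω → List (Fin m)} (h : EquidistributedAt l k c)
    (S : Set.powersetCard V m) {R : Finset V} (hR : #R = k) {x : V} (hx : x ∉ R)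
    (hRS : R ⊆ S) (hxS : x ∈ S) : mass 1 {ω | ListsThen ((l ω).map (enum S)) R x} = c := by
  obtain ⟨R, rfl⟩ := exists_map_enum_eq hRS
  obtain ⟨x, -, rfl⟩ := mem_map.1 ((map_enum_univ S).symm ▸ Set.powersetCard.mem_coe_iff.2 hxS)
  simp only [listsThen_map]
  exact h R (by rwa [card_map] at hR) x (by simpa using hx)

end EquidistributedAt

end Equidistributed

section SplitList

variable {Ω V : Type*} [Fintype V] {m m' k : ℕ} {c : ℝ≥0} {a : Ω → List (Fin m)}
  {b : Ω → List (Fin m')}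

/-- List an `m`-element subset of `V` in the order given by `a`. The subset and the index `ω` are
both chosen freely. -/
noncomputable def subsetList (a : Ω → List (Fin m)) (p : Set.powersetCard V m × Ω) : List V :=
  (a p.2).map (enum p.1)

theorem EquidistributedAt.of_subset [Fintype Ω] (h : EquidistributedAt a k c)
    (ha : ∀ ω, Enumerates (a ω) univ) (hk : k < m) :
    EquidistributedAt (V := V) (subsetList a) k
      ((Fintype.card V - (k + 1)).choose (m - (k + 1)) * c) := by
  classical
  intro R hR x hx
  have hcard : #(insert x R) = k + 1 := by rw [card_insert_of_notMem hx, hR]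
  have hmass (S : Set.powersetCard V m) :
      mass 1 {ω | ListsThen ((a ω).map (enum S)) R x} = if insert x R ⊆ S then c else 0 := by
    split_ifs with hS
    · obtain ⟨hxS, hRS⟩ := insert_subset_iff.1 hS
      exact h.mass_listsThen_map_enum S hR hx hRS hxS
    · exact mass_eq_zero fun ω hω => hS (hω.insert_subset ((ha ω).map_enum S))
  calc mass 1 {p | ListsThen (subsetList a p) R x}
      = ∑ S, mass 1 {ω | ListsThen ((a ω).map (enum S)) R x} :=
        mass_eq_sum_fibers (Equiv.refl _) _ _
    _ = ∑ S : Set.powersetCard V m, if insert x R ⊆ S then c else 0 :=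
        sum_congr rfl fun S _ => hmass S
    _ = (Fintype.card V - (k + 1)).choose (m - (k + 1)) * c := by
        rw [← sum_filter, sum_const, nsmul_eq_mul,
          card_powersetCard_filter_superset (hcard.trans_le hk), hcard]

variable [DecidableEq V]

/-- List an `m`-element subset of `V` in the order given by `a`, then its complement in the order
given by `b`. -/
noncomputable def splitList (hV : m' + m = Fintype.card V) (a : Ω → List (Fin m))
    (b : Ω → List (Fin m')) (p : Set.powersetCard V m × Ω) : List V :=
  subsetList a p ++ (b p.2).map (enum (Set.powersetCard.compl hV p.1))

variable {hV : m' + m = Fintype.card V}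

theorem enumerates_splitList {p : Set.powersetCard V m × Ω} (ha : Enumerates (a p.2) univ)
    (hb : Enumerates (b p.2) univ) : Enumerates (splitList hV a b p) univ := by
  rw [← union_compl (p.1 : Finset V), ← disjUnion_eq_union _ _ disjoint_compl_right]
  exact (ha.map_enum _).append_disjUnion (hb.map_enum _) _

theorem splitList_injective (ha : ∀ ω, Enumerates (a ω) univ) (hb : Function.Injective b) :
    Function.Injective (splitList hV a b) := by
  rintro ⟨S, ω⟩ ⟨S', ω'⟩ h
  have hS := (ha ω).map_enum S
  have hS' := (ha ω').map_enum S'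
  obtain ⟨h₁, h₂⟩ := List.append_inj h (by
    rw [subsetList, subsetList, hS.length_eq, hS'.length_eq, S.2, S'.2])
  rw [show (a ω).map (enum S) = (a ω').map (enum S') from h₁] at hS
  obtain rfl : S = S' := Subtype.ext (val_injective (hS.symm.trans hS'))
  exact congrArg _ (hb ((enum _).injective.list_map h₂))

namespace EquidistributedAt

variable [Fintype Ω]

theorem splitList_left (h : EquidistributedAt a k c) (ha : ∀ ω, Enumerates (a ω) univ)
    (hk : k < m) :
    EquidistributedAt (splitList hV a b) k
      ((Fintype.card V - (k + 1)).choose (m - (k + 1)) * c) := by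
  intro R hR x hx
  have hlen (p : Set.powersetCard V m × Ω) : #R < (subsetList a p).length := by
    rwa [subsetList, List.length_map, (ha _).length_eq, card_univ, Fintype.card_fin, hR]
  simp only [splitList, listsThen_append_left (hlen _)]
  exact h.of_subset ha hk R hR x hx

theorem splitList_right (h : EquidistributedAt b (k - m) c) (ha : ∀ ω, Enumerates (a ω) univ)
    (hk : m ≤ k) : EquidistributedAt (splitList hV a b) k (k.choose m * c) := by
  intro R hR x hx
  have hmass (S : Set.powersetCard V m) :
      mass 1 {ω | ListsThen (splitList hV a b (S, ω)) R x} =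
        if (S : Finset V) ⊆ R then c else 0 := by
    have hS : #(S : Finset V) = m := Set.powersetCard.card_eq S
    simp only [splitList, subsetList,
      listsThen_append_right ((ha _).map_enum S) (hS.trans_le (hR ▸ hk))]
    split_ifs with hSR
    · simp only [hSR, true_and]
      refine h.mass_listsThen_map_enum _ ?_ ?_ ?_ ?_
      · rw [card_sdiff_of_subset hSR, hR, hS]
      · exact fun h => hx (mem_sdiff.1 h).1
      · exact fun y hy => mem_compl.2 (mem_sdiff.1 hy).2
      · exact mem_compl.2 fun h => hx (hSR h)
    · exact mass_eq_zero fun ω hω => hSR hω.1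
  calc mass 1 {p | ListsThen (splitList hV a b p) R x}
      = ∑ S, mass 1 {ω | ListsThen (splitList hV a b (S, ω)) R x} :=
        mass_eq_sum_fibers (Equiv.refl _) _ _
    _ = ∑ S : Set.powersetCard V m, if (S : Finset V) ⊆ R then c else 0 :=
        sum_congr rfl fun S _ => hmass S
    _ = k.choose m * c := by
        rw [← sum_filter, sum_const, nsmul_eq_mul, card_powersetCard_filter_subset, hR]

end EquidistributedAt

end SplitList

/-- A finite indexed family of repetition-free lists of length `ℓ` of elements of `V`. -/
structure ListFamily (V : Type*) (ℓ : ℕ) where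
  Ω : Type
  [fintype : Fintype Ω]
  [nonempty : Nonempty Ω]
  list : Ω → List V
  nodup : ∀ ω, (list ω).Nodup
  length_eq : ∀ ω, (list ω).length = ℓ

attribute [instance] ListFamily.fintype ListFamily.nonempty

theorem ListFamily.enumerates_univ {V : Type*} [Fintype V] {ℓ : ℕ} (F : ListFamily V ℓ)
    (hℓ : Fintype.card V = ℓ) (ω : F.Ω) : Enumerates (F.list ω) univ :=
  congrArg Finset.val
    (eq_univ_of_card ⟨(F.list ω : Multiset V), Multiset.coe_nodup.2 (F.nodup ω)⟩
      ((F.length_eq ω).trans hℓ.symm))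

/-- There are at most `N` distinct orderings of `Fin n` of which a uniformly random one has, given
the set of its first `k` entries, an exactly uniform next entry, for each `k`. -/
def HasBalancedFamily (n N : ℕ) : Prop :=
  ∃ F : ListFamily (Fin n) n, Function.Injective F.list ∧
    (∀ k, ∃ c, EquidistributedAt F.list k c) ∧ Fintype.card F.Ω ≤ N

namespace HasBalancedFamily

theorem mono {n N N' : ℕ} (h : HasBalancedFamily n N) (hN : N ≤ N') : HasBalancedFamily n N' :=
  let ⟨F, hinj, hbal, hcard⟩ := h
  ⟨F, hinj, hbal, hcard.trans hN⟩

theorem of_split {n m m' N : ℕ} (hn : m' + m = n) {Ω : Type} [Fintype Ω] [Nonempty Ω]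
    {a : Ω → List (Fin m)} {b : Ω → List (Fin m')} (ha : ∀ ω, Enumerates (a ω) univ)
    (hb : ∀ ω, Enumerates (b ω) univ) (hinj : Function.Injective b)
    (hab : ∀ k, ∃ c, EquidistributedAt a k c) (hbb : ∀ k, ∃ c, EquidistributedAt b k c)
    (hN : Fintype.card Ω ≤ N) : HasBalancedFamily n (n.choose m * N) := by
  have hV : m' + m = Fintype.card (Fin n) := hn.trans (Fintype.card_fin n).symm
  have henum (p) : Enumerates (splitList hV a b p) univ := enumerates_splitList (ha _) (hb _)
  have hcard : Fintype.card (Set.powersetCard (Fin n) m) = n.choose m := by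
    rw [card_powersetCard_eq_choose, Fintype.card_fin]
  have hnonempty : Nonempty (Set.powersetCard (Fin n) m) :=
    Fintype.card_pos_iff.1 (hcard ▸ Nat.choose_pos (by omega))
  refine ⟨⟨Set.powersetCard (Fin n) m × Ω, splitList hV a b, fun p => (henum p).nodup,
    fun p => by simpa using (henum p).length_eq⟩, splitList_injective ha hinj, fun k => ?_, ?_⟩
  · rcases lt_or_ge k m with hk | hk
    · obtain ⟨c, hc⟩ := hab k
      exact ⟨_, hc.splitList_left ha hk⟩
    · obtain ⟨c, hc⟩ := hbb (k - m)
      exact ⟨_, hc.splitList_right ha hk⟩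
  · rw [Fintype.card_prod, hcard]
    exact Nat.mul_le_mul_left _ hN

theorem double {m N : ℕ} (h : HasBalancedFamily m N) : HasBalancedFamily (2 * m) (4 ^ m * N) := by
  obtain ⟨F, hinj, hbal, hcard⟩ := h
  have henum := F.enumerates_univ (Fintype.card_fin m)
  refine (of_split (two_mul m).symm henum henum hinj hbal hbal hcard).mono ?_
  have hchoose := Nat.choose_le_two_pow (2 * m) m
  rw [pow_mul] at hchoose
  exact Nat.mul_le_mul_right _ hchoose

theorem succ {m N : ℕ} (h : HasBalancedFamily m N) :
    HasBalancedFamily (m + 1) ((m + 1) * N) := by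
  obtain ⟨F, hinj, hbal, hcard⟩ := h
  have henum := F.enumerates_univ (Fintype.card_fin m)
  have hsingle : ∀ k, ∃ c, EquidistributedAt (fun _ : F.Ω => [(0 : Fin 1)]) k c := by
    refine fun k => ⟨Fintype.card F.Ω, fun R hR x hx => ?_⟩
    obtain rfl : R = ∅ :=
      eq_empty_of_forall_notMem fun y hy => hx (Subsingleton.elim y x ▸ hy)
    obtain rfl : x = 0 := Subsingleton.elim _ _
    simp [mass, ListsThen, Enumerates]
  simpa using of_split rfl (fun _ => rfl) henum hinj hsingle hbal hcard

end HasBalancedFamily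

theorem hasBalancedFamily (n : ℕ) : HasBalancedFamily n (16 ^ n) := by
  induction n using Nat.evenOddRec with
  | h0 =>
    refine ⟨⟨Unit, fun _ => [], by simp, by simp⟩, Function.injective_of_subsingleton _,
      fun _ => ⟨0, fun _ _ x => x.elim0⟩, by simp⟩
  | h_even m ih =>
    refine ih.double.mono ?_
    rw [pow_mul, ← mul_pow]
    exact Nat.pow_le_pow_left (by norm_num) m
  | h_odd m ih =>
    refine ih.double.succ.mono ?_
    have hm : 2 * m + 1 ≤ 4 ^ m * 16 := by
      have := Nat.lt_pow_self (n := m) (a := 4) (by norm_num)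
      omega
    calc (2 * m + 1) * (4 ^ m * 16 ^ m) ≤ (4 ^ m * 16) * (4 ^ m * 16 ^ m) :=
          Nat.mul_le_mul_right _ hm
      _ = 16 ^ (2 * m + 1) := by
          rw [pow_succ, pow_mul, show (16 : ℕ) ^ 2 = 4 * 4 * 16 by norm_num, mul_pow, mul_pow]
          ring

theorem choose_two_mul_le {h a : ℕ} (ha : a ≤ h) :
    (2 * h).choose h ≤ 16 ^ a * (2 * h - a).choose h := by
  rcases le_or_gt h (2 * a) with hle | hlt
  · calc (2 * h).choose h ≤ 2 ^ (2 * h) := Nat.choose_le_two_pow _ _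
      _ ≤ 2 ^ (4 * a) := Nat.pow_le_pow_right (by norm_num) (by omega)
      _ = 16 ^ a := by rw [pow_mul]; norm_num
      _ ≤ 16 ^ a * (2 * h - a).choose h :=
        Nat.le_mul_of_pos_right _ (Nat.choose_pos (by omega))
  · clear ha
    induction a with
    | zero => simp
    | succ a ih =>
      refine (ih (by omega)).trans ?_
      rw [pow_succ, mul_assoc]
      refine Nat.mul_le_mul_left _ ?_
      obtain ⟨m, hm, hm'⟩ : ∃ m, 2 * h - a = m + 1 ∧ 2 * h - (a + 1) = m :=
        ⟨2 * h - a - 1, by omega, by omega⟩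
      rw [hm, hm']
      refine Nat.le_of_mul_le_mul_right (c := m + 1 - h) ?_ (by omega)
      calc (m + 1).choose h * (m + 1 - h) = m.choose h * (m + 1) :=
            (Nat.choose_mul_succ_eq m h).symm
        _ ≤ m.choose h * (16 * (m + 1 - h)) := Nat.mul_le_mul_left _ (by omega)
        _ = 16 * m.choose h * (m + 1 - h) := by ring

/-- A finite family of orderings `list τ` of `h`-element subsets `half τ` of a `2h`-element set. A
uniformly random one lists every element with hazard at most `1/h`, and its complement contains any
given `a` elements with probability at least `16⁻ᵃ`. -/
structure HalvingFamily (h : ℕ) where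
  T : Type
  [fintype : Fintype T]
  [nonempty : Nonempty T]
  half : T → Set.powersetCard (Fin (2 * h)) h
  list : T → List (Fin (2 * h))
  enumerates : ∀ τ, Enumerates (list τ) (half τ)
  hazardLE : ∀ k, HazardLE 1 list k (h : ℝ≥0)⁻¹
  card_le : Fintype.card T ≤ 64 ^ h
  spread : ∀ A : Finset (Fin (2 * h)), #A ≤ h →
    Fintype.card T ≤ 16 ^ #A * #{τ | Disjoint (half τ : Finset (Fin (2 * h))) A}

attribute [instance] HalvingFamily.fintype HalvingFamily.nonempty

theorem hazardLE_subsetList {Ω : Type*} [Fintype Ω] {h k : ℕ} {c : ℝ≥0} {a : Ω → List (Fin h)}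
    (ha : ∀ ω, Enumerates (a ω) univ) (hak : EquidistributedAt a k c) :
    HazardLE 1 (subsetList (V := Fin (2 * h)) a) k (h : ℝ≥0)⁻¹ := by
  rcases lt_or_ge k h with hk | hk
  · refine ((hak.of_subset ha hk).hazardLE fun τ => ((ha τ.2).map_enum τ.1).nodup).mono ?_
    rw [Fintype.card_fin]
    have hpos : 0 < h := by omega
    gcongr
    omega
  · exact .of_length_le fun τ => by
      rwa [subsetList, List.length_map, (ha _).length_eq, card_univ, Fintype.card_fin]

theorem card_powersetCard_le_sixteen_pow_mul {h : ℕ} {A : Finset (Fin (2 * h))} (hA : #A ≤ h) :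
    Fintype.card (Set.powersetCard (Fin (2 * h)) h) ≤
      16 ^ #A *
        #{S : Set.powersetCard (Fin (2 * h)) h | Disjoint (S : Finset (Fin (2 * h))) A} := by
  simp only [← le_compl_iff_disjoint_right]
  rw [card_powersetCard_eq_choose, Fintype.card_fin,
    (card_powersetCard_filter_subset Aᶜ : _ = _), card_compl, Fintype.card_fin]
  exact choose_two_mul_le hA

theorem nonempty_halvingFamily (h : ℕ) : Nonempty (HalvingFamily h) := by
  obtain ⟨F, -, hbal, hcard⟩ := hasBalancedFamily h
  have henum := F.enumerates_univ (Fintype.card_fin h)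
  have hcardSubsets : Fintype.card (Set.powersetCard (Fin (2 * h)) h) = (2 * h).choose h := by
    rw [card_powersetCard_eq_choose, Fintype.card_fin]
  have : Nonempty (Set.powersetCard (Fin (2 * h)) h) :=
    Fintype.card_pos_iff.1 (hcardSubsets ▸ Nat.choose_pos (by omega))
  refine ⟨⟨Set.powersetCard (Fin (2 * h)) h × F.Ω, Prod.fst, subsetList F.list,
    fun τ => (henum τ.2).map_enum τ.1, fun k => hazardLE_subsetList henum (hbal k).choose_spec,
    ?_, fun A hA => ?_⟩⟩
  · have hchoose := Nat.choose_le_two_pow (2 * h) h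
    rw [pow_mul] at hchoose
    rw [Fintype.card_prod, hcardSubsets]
    exact (Nat.mul_le_mul hchoose hcard).trans_eq (mul_pow _ _ _).symm
  · have hprod : univ.filter (fun τ : Set.powersetCard (Fin (2 * h)) h × F.Ω =>
          Disjoint (τ.1 : Finset (Fin (2 * h))) A) =
        univ.filter (fun S : Set.powersetCard (Fin (2 * h)) h =>
          Disjoint (S : Finset (Fin (2 * h))) A) ×ˢ univ := by
      ext
      simp
    rw [hprod, card_product, Fintype.card_prod, ← mul_assoc]
    exact Nat.mul_le_mul_right _ (card_powersetCard_le_sixteen_pow_mul hA)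

section Rounding

variable {ι : Type*} [Fintype ι] {M t : ℕ}

theorem exists_sum_eq_of_floor_le {p : ι → ℝ≥0} (hp : ∑ i, p i = M) :
    ∃ c : ι → ℕ, ∑ i, c i = M ∧ ∀ i, ⌊p i⌋₊ ≤ c i ∧ c i ≤ ⌊p i⌋₊ + 1 := by
  classical
  have hle : ∑ i, ⌊p i⌋₊ ≤ M := by
    rw [← Nat.cast_le (α := ℝ≥0), Nat.cast_sum, ← hp]
    exact sum_le_sum fun i _ => Nat.floor_le zero_le
  have hgap : M - ∑ i, ⌊p i⌋₊ ≤ #(univ : Finset ι) := by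
    have : M ≤ ∑ i, (⌊p i⌋₊ + 1) := by
      rw [← Nat.cast_le (α := ℝ≥0), Nat.cast_sum, ← hp]
      exact sum_le_sum fun i _ => (Nat.lt_floor_add_one _).le.trans_eq (Nat.cast_succ _).symm
    rw [sum_add_distrib, ← card_eq_sum_ones] at this
    omega
  obtain ⟨s, -, hs⟩ := exists_subset_card_eq hgap
  refine ⟨fun i => ⌊p i⌋₊ + if i ∈ s then 1 else 0, ?_, fun i => by dsimp only; split_ifs <;> omega⟩
  rw [sum_add_distrib, sum_ite_mem, univ_inter, ← card_eq_sum_ones, hs]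
  omega

theorem exists_pushforward_one_eq {c : ι → ℕ} (hc : ∑ i, c i = M) :
    ∃ f : Fin M → ι, ∀ i, pushforward f 1 i = c i := by
  classical
  let e : Fin M ≃ Σ i, Fin (c i) := Fintype.equivOfCardEq (by simp [hc])
  refine ⟨fun t => (e t).1, fun i => ?_⟩
  have hfiber : {t // (e t).1 = i} ≃ Fin (c i) :=
    (e.subtypeEquiv fun _ => Iff.rfl).trans (Equiv.sigmaSubtype i)
  rw [pushforward, mass_one_eq_card, ← Fintype.card_fin (c i), ← Fintype.card_congr hfiber,
    Fintype.card_subtype]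
  rfl

theorem exists_withinFactor_pushforward {w : ι → ℝ≥0} (hw : ∑ i, w i ≠ 0) (ht : 0 < t)
    (hM : ∀ i, t * ∑ j, w j ≤ M * w i) :
    ∃ f : Fin M → ι, WithinFactor (1 + (t : ℝ≥0)⁻¹) ((M : ℝ≥0) • w)
      ((∑ i, w i) • pushforward f 1) := by
  set W := ∑ i, w i
  obtain ⟨c, hc, hcp⟩ := exists_sum_eq_of_floor_le (p := fun i => M * w i / W) (M := M) (by
    rw [← sum_div, ← mul_sum, mul_div_cancel_right₀ _ hw])
  obtain ⟨f, hf⟩ := exists_pushforward_one_eq hc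
  have hfac {x : ℝ≥0} (hx : t ≤ x) : x + 1 ≤ (1 + (t : ℝ≥0)⁻¹) * x := by
    rw [one_add_mul]
    gcongr
    rwa [← div_eq_inv_mul, one_le_div (by exact_mod_cast ht)]
  have hp (i) : (t : ℝ≥0) ≤ M * w i / W := (le_div_iff₀ (pos_iff_ne_zero.2 hw)).2 (hM i)
  have hscale (i) : M * w i = W * (M * w i / W) := (mul_div_cancel₀ _ hw).symm
  refine ⟨f, fun i => ?_, fun i => ?_⟩ <;>
    simp only [Pi.smul_apply, smul_eq_mul, hf] <;> rw [hscale i, mul_left_comm] <;> gcongr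
  · have htc : (t : ℝ≥0) ≤ c i := by exact_mod_cast (Nat.le_floor (hp i)).trans (hcp i).1
    refine le_trans ?_ (hfac htc)
    exact (Nat.lt_floor_add_one _).le.trans (by gcongr; exact (hcp i).1)
  · refine le_trans ?_ (hfac (hp i))
    calc (c i : ℝ≥0) ≤ ⌊M * w i / W⌋₊ + 1 := by exact_mod_cast (hcp i).2
      _ ≤ _ := by gcongr; exact Nat.floor_le zero_le

end Rounding

section Coupling

variable {I U Ω V : Type*} {M t : ℕ} {g : I → U} {ν : I → ℝ≥0}

theorem exists_coupling [Fintype I] (hg : Function.Surjective g) (hν : ∀ i, ν i ≠ 0) (ht : 0 < t)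
    (hM : ∀ i, t * ∑ j, ν j ≤ M * ν i) :
    ∃ f : U → Fin M → I, (∀ u τ, g (f u τ) = u) ∧
      WithinFactor (1 + (t : ℝ≥0)⁻¹) ((M : ℝ≥0) • ν)
        fun i => pushforward g ν (g i) * pushforward (f (g i)) 1 i := by
  classical
  have hfiber (u) : ∑ i : {i // g i = u}, ν i = pushforward g ν u := by
    simp only [pushforward, mass, Set.indicator_apply]
    rw [← sum_filter]
    exact (sum_subtype _ (by simp) _).symm
  have hround (u) : ∃ f : Fin M → {i // g i = u}, WithinFactor (1 + (t : ℝ≥0)⁻¹)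
      ((M : ℝ≥0) • fun i : {i // g i = u} => ν i) (pushforward g ν u • pushforward f 1) := by
    obtain ⟨i, hi⟩ := hg u
    rw [← hfiber]
    refine exists_withinFactor_pushforward ?_ ht fun i => ?_
    · exact (sum_pos (s := (univ : Finset {i // g i = u})) (fun j _ => pos_iff_ne_zero.2 (hν j))
        ⟨⟨i, hi⟩, mem_univ _⟩).ne'
    · refine le_trans ?_ (hM i)
      rw [hfiber]
      exact mul_le_mul_right mass_le_sum _
  choose f hf using hround
  have hval (i) :
      pushforward (fun τ => (f (g i) τ : I)) 1 i = pushforward (f (g i)) 1 ⟨i, rfl⟩ := by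
    simp only [pushforward, mass, Set.indicator_apply, Set.mem_preimage, Set.mem_singleton_iff,
      Subtype.ext_iff]
  refine ⟨fun u τ => f u τ, fun u τ => (f u τ).2, fun i => ?_, fun i => ?_⟩ <;>
    simp only [Pi.smul_apply, hval]
  exacts [(hf (g i)).1 ⟨i, rfl⟩, (hf (g i)).2 ⟨i, rfl⟩]

variable [Fintype U] [Fintype Ω] {f : U → Fin M → I} {μ : U → ℝ≥0}

theorem pushforward_coupling (hf : ∀ u τ, g (f u τ) = u) :
    pushforward (fun p : U × Fin M × Ω => (f p.1 p.2.1, p.2.2)) (fun p => μ p.1) =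
      fun p : I × Ω => μ (g p.1) * pushforward (f (g p.1)) 1 p.1 := by
  classical
  ext ⟨i, s⟩
  simp only [pushforward, mass, Set.indicator_apply, Set.mem_preimage, Set.mem_singleton_iff,
    Fintype.sum_prod_type, Prod.mk.injEq, ite_and, sum_ite_irrel, sum_const_zero, sum_ite_eq',
    mem_univ, if_true, mul_sum, Pi.one_apply, mul_ite, mul_one, mul_zero]
  rw [sum_eq_single_of_mem (g i) (mem_univ _)]
  refine fun u _ hu => sum_eq_zero fun τ _ => if_neg ?_
  rintro rfl
  exact hu (hf u τ).symm

theorem HazardLE.coupling [Fintype I] {k : ℕ} {β r : ℝ≥0} {l : I × Ω → List V}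
    (h : HazardLE (fun p => ν p.1) l k β) (hf : ∀ u τ, g (f u τ) = u)
    (hr : WithinFactor r ((M : ℝ≥0) • ν) fun i => μ (g i) * pushforward (f (g i)) 1 i) :
    HazardLE (fun p : U × Fin M × Ω => μ p.1) (fun p => l (f p.1 p.2.1, p.2.2)) k (β * r ^ 2) := by
  refine pushforward_iff.1 ((h.smul (r := M)).of_withinFactor ?_)
  rw [pushforward_coupling hf]
  exact ⟨fun p => hr.1 p.1, fun p => hr.2 p.1⟩

end Coupling

section Survivors

variable {V W : Type*} {h : ℕ}

/-- The survivors of two copies of `V`, as a subset of the disjoint union of the copies. -/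
def pool (u₁ u₂ : Set.powersetCard V h) : Set.powersetCard (V ⊕ V) (2 * h) :=
  ⟨(u₁ : Finset V).disjSum u₂, by
    rw [Set.powersetCard.mem_iff, card_disjSum, Set.powersetCard.card_eq u₁,
      Set.powersetCard.card_eq u₂, two_mul]⟩

theorem compl_pool [Fintype V] [DecidableEq V] (u₁ u₂ : Set.powersetCard V h) :
    (pool u₁ u₂ : Finset (V ⊕ V))ᶜ = ((u₁ : Finset V)ᶜ).disjSum (u₂ : Finset V)ᶜ := by
  ext (x | x) <;> simp [pool]

variable [DecidableEq W]

/-- The half of `P` that is left after removing the elements at the places in `D`. -/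
noncomputable def survivors (P : Set.powersetCard W (2 * h))
    (D : Set.powersetCard (Fin (2 * h)) h) : Set.powersetCard W h :=
  ⟨(P : Finset W) \ (D : Finset (Fin (2 * h))).map (enum P), by
    rw [Set.powersetCard.mem_iff, ← map_enum_univ P, ← Finset.map_sdiff, card_map,
      card_sdiff_of_subset (subset_univ _), card_univ, Fintype.card_fin,
      Set.powersetCard.card_eq D]
    omega⟩

variable {P : Set.powersetCard W (2 * h)} {D : Set.powersetCard (Fin (2 * h)) h}

theorem coe_survivors :
    (survivors P D : Finset W) = (P : Finset W) \ (D : Finset (Fin (2 * h))).map (enum P) :=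
  rfl

theorem map_enum_subset_survivors_iff {A : Finset (Fin (2 * h))} :
    A.map (enum P) ⊆ survivors P D ↔ Disjoint (D : Finset (Fin (2 * h))) A := by
  rw [coe_survivors, ← map_enum_univ P, ← Finset.map_sdiff]
  exact map_subset_map.trans (by rw [← compl_eq_univ_sdiff]; exact le_compl_iff_disjoint_left)

theorem enumerates_compl_survivors [Fintype W] {a : List W} {b : List (Fin (2 * h))}
    (ha : Enumerates a (P : Finset W)ᶜ) (hb : Enumerates b D) :
    Enumerates (a ++ b.map (enum P)) (survivors P D : Finset W)ᶜ := by
  have hsub : (D : Finset (Fin (2 * h))).map (enum P) ⊆ P :=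
    map_enum_univ P ▸ map_subset_map.2 (subset_univ _)
  have hunion : (survivors P D : Finset W)ᶜ =
      (P : Finset W)ᶜ ∪ (D : Finset (Fin (2 * h))).map (enum P) := by
    rw [coe_survivors, sdiff_eq_inter_compl, compl_inter, compl_compl]
  rw [hunion, ← disjUnion_eq_union _ _ (disjoint_compl_left.mono_right hsub)]
  exact ha.append_disjUnion (hb.map _) _

end Survivors

/-- A random `h`-element set of survivors, together with random orderings of the others. The set
`u` is chosen with probability proportional to `weight u`, and given `u`, a uniformly random seed
determines the ordering `list u s`. The weights are not normalised. -/
structure EliminationScheme (V Ω : Type*) [Fintype V] [DecidableEq V] [Fintype Ω] (h : ℕ)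
    (q β : ℝ≥0) where
  weight : Set.powersetCard V h → ℝ≥0
  sum_weight_ne_zero : ∑ u, weight u ≠ 0
  list : Set.powersetCard V h → Ω → List V
  enumerates : ∀ u s, Enumerates (list u s) (u : Finset V)ᶜ
  spread : ∀ A : Finset V, #A ≤ h →
    q ^ #A * ∑ u, weight u ≤ mass weight {u | A ⊆ (u : Finset V)}
  hazardLE : ∀ k, HazardLE (fun p : Set.powersetCard V h × Ω => weight p.1)
    (fun p => list p.1 p.2) k β

namespace EliminationScheme

variable {V Ω : Type*} [Fintype V] [DecidableEq V] [Fintype Ω] {h k M t : ℕ} {q β : ℝ≥0}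

section Merge

variable (S : EliminationScheme V Ω h q β) (H : HalvingFamily h)

theorem length_list (u : Set.powersetCard V h) (s : Ω) :
    (S.list u s).length = Fintype.card V - h := by
  rw [(S.enumerates u s).length_eq, card_compl, Set.powersetCard.card_eq u]

theorem pow_mul_sum_weight_le (u : Set.powersetCard V h) :
    q ^ h * ∑ v, S.weight v ≤ S.weight u := by
  have hu : {v : Set.powersetCard V h | (u : Finset V) ⊆ v} = {u} := by
    ext v
    refine ⟨fun huv => Subtype.ext ?_, fun hv => hv ▸ subset_refl (u : Finset V)⟩
    exact (eq_of_subset_of_card_le huv (by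
      rw [Set.powersetCard.card_eq u, Set.powersetCard.card_eq v])).symm
  have hspread := S.spread u (Set.powersetCard.card_eq u).le
  rw [Set.powersetCard.card_eq u, hu] at hspread
  refine hspread.trans_eq ?_
  simp [mass, Set.indicator_apply]

/-- The random choices in the merging of two copies of a scheme, apart from their common seed: the
survivors of each copy, and the half of the pool that is to be listed. -/
abbrev MergeChoice (V : Type*) (H : HalvingFamily h) : Type _ :=
  Set.powersetCard V h × Set.powersetCard V h × H.T

/-- The survivors of both copies are chosen independently. -/
noncomputable def mergeWeight (i : MergeChoice V H) : ℝ≥0 :=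
  S.weight i.1 * S.weight i.2.1

/-- List each copy up to its survivors, using the same seed twice, and then half of the pool. -/
noncomputable def mergeList (i : MergeChoice V H) (s : Ω) : List (V ⊕ V) :=
  (S.list i.1 s).map Sum.inl ++ (S.list i.2.1 s).map Sum.inr ++
    (H.list i.2.2).map (enum (pool i.1 i.2.1))

variable {H} in
/-- The part of the pool that survives the merging. -/
noncomputable def mergeSurvivors (i : MergeChoice V H) : Set.powersetCard (V ⊕ V) h :=
  survivors (pool i.1 i.2.1) (H.half i.2.2)

theorem enumerates_append (u₁ u₂ : Set.powersetCard V h) (s : Ω) :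
    Enumerates ((S.list u₁ s).map Sum.inl ++ (S.list u₂ s).map Sum.inr)
      (pool u₁ u₂ : Finset (V ⊕ V))ᶜ := by
  rw [compl_pool]
  exact (S.enumerates u₁ s).append_disjSum (S.enumerates u₂ s)

theorem enumerates_mergeList (i : MergeChoice V H) (s : Ω) :
    Enumerates (S.mergeList H i s) (mergeSurvivors i : Finset (V ⊕ V))ᶜ :=
  enumerates_compl_survivors (S.enumerates_append i.1 i.2.1 s) (H.enumerates i.2.2)

theorem sum_mergeWeight :
    ∑ i, S.mergeWeight H i = (∑ u, S.weight u) ^ 2 * Fintype.card H.T := by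
  simp only [mergeWeight, Fintype.sum_prod_type, sum_const, card_univ, nsmul_eq_mul,
    ← mul_sum, ← sum_mul]
  ring

theorem hazardLE_mergeList_left (hk : k < Fintype.card V - h) :
    HazardLE (fun p : MergeChoice V H × Ω => S.mergeWeight H p.1)
      (fun p => S.mergeList H p.1 p.2) k β := by
  refine .of_fibers (A := Set.powersetCard V h × H.T) (Ω := Set.powersetCard V h × Ω)
    ⟨fun p => ((p.2.1, p.1.1, p.1.2), p.2.2), fun q => ((q.1.2.1, q.1.2.2), (q.1.1, q.2)),
      fun _ => rfl, fun _ => rfl⟩ fun b => ?_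
  have hweight : (fun p : Set.powersetCard V h × Ω => S.mergeWeight H (p.1, b.1, b.2)) =
      S.weight b.1 • fun p => S.weight p.1 :=
    funext fun _ => mul_comm _ _
  change HazardLE (fun p : Set.powersetCard V h × Ω => S.mergeWeight H (p.1, b.1, b.2)) _ k β
  rw [hweight]
  refine ((((S.hazardLE k).map Function.Embedding.inl).smul).append_left fun p => ?_).append_left
    fun p => ?_
  · rwa [List.length_map, S.length_list]
  · rw [List.length_append, List.length_map, S.length_list]
    exact Nat.lt_add_right _ hk

theorem hazardLE_mergeList_right (hk : Fintype.card V - h ≤ k)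
    (hk' : k < 2 * (Fintype.card V - h)) :
    HazardLE (fun p : MergeChoice V H × Ω => S.mergeWeight H p.1)
      (fun p => S.mergeList H p.1 p.2) k β := by
  refine .of_fibers (A := Set.powersetCard V h × H.T) (Ω := Set.powersetCard V h × Ω)
    ⟨fun p => ((p.1.1, p.2.1, p.1.2), p.2.2), fun q => ((q.1.1, q.1.2.2), (q.1.2.1, q.2)),
      fun _ => rfl, fun _ => rfl⟩ fun b => ?_
  have hS : #((b.1 : Finset V)ᶜ.map Function.Embedding.inl : Finset (V ⊕ V)) =
      Fintype.card V - h := by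
    rw [card_map, card_compl, Set.powersetCard.card_eq b.1]
  have hcopy := ((S.hazardLE (k - (Fintype.card V - h))).map
    (Function.Embedding.inr (α := V))).smul (r := S.weight b.1)
  have hweight : (fun p : Set.powersetCard V h × Ω => S.mergeWeight H (b.1, p.1, b.2)) =
      S.weight b.1 • fun p => S.weight p.1 :=
    funext fun _ => rfl
  rw [← hweight, ← hS] at hcopy
  have hcopies : HazardLE (fun p : Set.powersetCard V h × Ω => S.mergeWeight H (b.1, p.1, b.2))
      (fun p => (S.list b.1 p.2).map Sum.inl ++ (S.list p.1 p.2).map Sum.inr) k β :=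
    hcopy.append_right (fun p => (S.enumerates b.1 p.2).map Function.Embedding.inl) (by rwa [hS])
  refine hcopies.append_left fun p => ?_
  rw [List.length_append, List.length_map, List.length_map, S.length_list, S.length_list]
  omega

theorem hazardLE_mergeList_pool (hβ : (h : ℝ≥0)⁻¹ ≤ β) (hk : 2 * (Fintype.card V - h) ≤ k) :
    HazardLE (fun p : MergeChoice V H × Ω => S.mergeWeight H p.1)
      (fun p => S.mergeList H p.1 p.2) k β := by
  refine .of_fibers (A := Set.powersetCard V h × Set.powersetCard V h × Ω) (Ω := H.T)
    ⟨fun p => ((p.1.1, p.1.2.1, p.2), p.1.2.2), fun q => ((q.1.1, q.1.2.1, q.2), q.1.2.2),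
      fun _ => rfl, fun _ => rfl⟩ fun b => ?_
  have hweight : (fun τ => S.mergeWeight H (b.1, b.2.1, τ)) =
      (S.weight b.1 * S.weight b.2.1) • (1 : H.T → ℝ≥0) :=
    funext fun _ => (mul_one _).symm
  have hhalf := (((H.hazardLE (k - #(pool b.1 b.2.1 : Finset (V ⊕ V))ᶜ)).mono hβ).map
    (enum (pool b.1 b.2.1))).smul (r := S.weight b.1 * S.weight b.2.1)
  rw [← hweight] at hhalf
  exact hhalf.append_right (fun _ => S.enumerates_append b.1 b.2.1 b.2.2) (by
    rw [card_compl, Set.powersetCard.card_eq (pool b.1 b.2.1), Fintype.card_sum]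
    omega)

theorem hazardLE_mergeList (hβ : (h : ℝ≥0)⁻¹ ≤ β) :
    HazardLE (fun p : MergeChoice V H × Ω => S.mergeWeight H p.1)
      (fun p => S.mergeList H p.1 p.2) k β := by
  rcases lt_or_ge k (Fintype.card V - h) with hk | hk
  · exact S.hazardLE_mergeList_left H hk
  rcases lt_or_ge k (2 * (Fintype.card V - h)) with hk' | hk'
  · exact S.hazardLE_mergeList_right H hk hk'
  · exact S.hazardLE_mergeList_pool H hβ hk'

theorem card_le_card_subset_survivors {W : Type*} [DecidableEq W] {P : Set.powersetCard W (2 * h)}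
    {A : Finset W} (hAP : A ⊆ P) (hA : #A ≤ h) :
    Fintype.card H.T ≤ 16 ^ #A * #{τ | A ⊆ (survivors P (H.half τ) : Finset W)} := by
  obtain ⟨A, rfl⟩ := exists_map_enum_eq hAP
  simp only [map_enum_subset_survivors_iff]
  rw [card_map] at hA ⊢
  exact H.spread A hA

theorem mul_mul_card_le_mass_mergeWeight {A : Finset (V ⊕ V)} (hA : #A ≤ h)
    (u₁ u₂ : Set.powersetCard V h) :
    {u : Set.powersetCard V h | A.toLeft ⊆ (u : Finset V)}.indicator S.weight u₁ *
      {u : Set.powersetCard V h | A.toRight ⊆ (u : Finset V)}.indicator S.weight u₂ *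
      Fintype.card H.T ≤ 16 ^ #A * mass (fun τ => S.mergeWeight H (u₁, u₂, τ))
        {τ | A ⊆ (mergeSurvivors (u₁, u₂, τ) : Finset (V ⊕ V))} := by
  by_cases hu : A.toLeft ⊆ u₁ ∧ A.toRight ⊆ u₂
  · have hpool : A ⊆ (pool u₁ u₂ : Finset (V ⊕ V)) := by
      rw [← toLeft_disjSum_toRight (u := A)]
      exact disjSum_mono hu.1 hu.2
    have hconst : (fun τ => S.mergeWeight H (u₁, u₂, τ)) =
        (S.weight u₁ * S.weight u₂) • (1 : H.T → ℝ≥0) := by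
      ext τ
      simp [mergeWeight]
    rw [Set.indicator_of_mem (by exact hu.1), Set.indicator_of_mem (by exact hu.2), hconst,
      mass_smul, mass_one_eq_card, mul_left_comm]
    gcongr
    exact_mod_cast card_le_card_subset_survivors H hpool hA
  · rcases not_and_or.1 hu with hu | hu <;> simp [hu]

theorem spread_mergeWeight {A : Finset (V ⊕ V)} (hA : #A ≤ h) :
    (q / 16) ^ #A * ∑ i, S.mergeWeight H i ≤
      mass (S.mergeWeight H) {i | A ⊆ (mergeSurvivors i : Finset (V ⊕ V))} := by
  have hcard := card_toLeft_add_card_toRight (u := A)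
  rw [div_pow, div_mul_eq_mul_div, div_le_iff₀ (by positivity), mul_comm (mass _ _),
    sum_mergeWeight]
  calc q ^ #A * ((∑ u, S.weight u) ^ 2 * Fintype.card H.T)
      = (q ^ #A.toLeft * ∑ u, S.weight u) * (q ^ #A.toRight * ∑ u, S.weight u) *
          Fintype.card H.T := by
        rw [← hcard, pow_add]
        ring
    _ ≤ mass S.weight {u | A.toLeft ⊆ (u : Finset V)} *
          mass S.weight {u | A.toRight ⊆ (u : Finset V)} * Fintype.card H.T := by
        gcongr <;> exact S.spread _ (by omega)
    _ ≤ ∑ u₁, ∑ u₂, 16 ^ #A * mass (fun τ => S.mergeWeight H (u₁, u₂, τ))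
          {τ | A ⊆ (mergeSurvivors (u₁, u₂, τ) : Finset (V ⊕ V))} := by
        rw [mass, mass, sum_mul_sum]
        simp only [sum_mul]
        exact sum_le_sum fun u₁ _ => sum_le_sum fun u₂ _ =>
          S.mul_mul_card_le_mass_mergeWeight H hA u₁ u₂
    _ = 16 ^ #A * mass (S.mergeWeight H) {i | A ⊆ (mergeSurvivors i : Finset (V ⊕ V))} := by
        rw [mass_eq_sum_fibers (Equiv.prodAssoc _ _ _), mul_sum, Fintype.sum_prod_type]
        rfl

theorem sum_mergeWeight_ne_zero : ∑ i, S.mergeWeight H i ≠ 0 := by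
  rw [sum_mergeWeight]
  exact mul_ne_zero (pow_ne_zero 2 S.sum_weight_ne_zero) (Nat.cast_ne_zero.2 Fintype.card_ne_zero)

include S in
theorem mergeSurvivors_surjective (hq : 0 < q) :
    Function.Surjective (mergeSurvivors : MergeChoice V H → Set.powersetCard (V ⊕ V) h) := by
  intro u
  by_contra! hu
  have hspread := S.spread_mergeWeight H (Set.powersetCard.card_eq u).le
  rw [mass_eq_zero, nonpos_iff_eq_zero] at hspread
  · exact mul_ne_zero (by positivity) (S.sum_mergeWeight_ne_zero H) hspread
  · refine fun i hi => hu i (Subtype.ext (eq_of_subset_of_card_le hi ?_).symm)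
    rw [Set.powersetCard.card_eq u, Set.powersetCard.card_eq (mergeSurvivors i)]

theorem mul_sum_mergeWeight_le (hM : t * 64 ^ h ≤ M * (q ^ h) ^ 2) (i : MergeChoice V H) :
    t * ∑ j, S.mergeWeight H j ≤ M * S.mergeWeight H i := by
  rw [sum_mergeWeight]
  calc (t : ℝ≥0) * ((∑ u, S.weight u) ^ 2 * Fintype.card H.T)
      ≤ t * ((∑ u, S.weight u) ^ 2 * 64 ^ h) := by
        gcongr
        exact_mod_cast H.card_le
    _ = t * 64 ^ h * (∑ u, S.weight u) ^ 2 := by ring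
    _ ≤ M * (q ^ h) ^ 2 * (∑ u, S.weight u) ^ 2 := by gcongr
    _ = M * ((q ^ h * ∑ u, S.weight u) * (q ^ h * ∑ u, S.weight u)) := by ring
    _ ≤ M * S.mergeWeight H i := by
        rw [mergeWeight]
        gcongr <;> exact S.pow_mul_sum_weight_le _

include S in
/-- The choices in the merging are determined by the new survivors and one of `M` equally likely
values, up to rounding their conditional probabilities to multiples of `1 / M`. -/
theorem nonempty_merge (hq : 0 < q) (hβ : (h : ℝ≥0)⁻¹ ≤ β) (ht : 0 < t)
    (hM : t * 64 ^ h ≤ M * (q ^ h) ^ 2) :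
    Nonempty (EliminationScheme (V ⊕ V) (Fin M × Ω) h (q / 16)
      (β * (1 + (t : ℝ≥0)⁻¹) ^ 2)) := by
  obtain ⟨H⟩ := nonempty_halvingFamily h
  have hpos (i) : S.mergeWeight H i ≠ 0 := by
    have hpow (u) : 0 < S.weight u := (mul_pos (pow_pos hq h)
      (pos_iff_ne_zero.2 S.sum_weight_ne_zero)).trans_le (S.pow_mul_sum_weight_le u)
    exact (mul_pos (hpow i.1) (hpow i.2.1)).ne'
  obtain ⟨f, hf, hfw⟩ := exists_coupling (S.mergeSurvivors_surjective H hq) hpos ht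
    (S.mul_sum_mergeWeight_le H hM)
  exact ⟨{
    weight := pushforward mergeSurvivors (S.mergeWeight H)
    sum_weight_ne_zero := by
      rw [sum_pushforward]
      exact S.sum_mergeWeight_ne_zero H
    list := fun u p => S.mergeList H (f u p.1) p.2
    enumerates := fun u p => by
      conv_rhs => rw [← hf u p.1]
      exact S.enumerates_mergeList H (f u p.1) p.2
    spread := fun A hA => by
      rw [sum_pushforward, mass_pushforward]
      exact S.spread_mergeWeight H hA
    hazardLE := fun k => (S.hazardLE_mergeList H hβ).coupling hf hfw }⟩

end Merge

theorem coe_powersetCard_eq_univ (u : Set.powersetCard (Fin h) h) : (u : Finset (Fin h)) = univ :=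
  eq_univ_of_card _ ((Set.powersetCard.card_eq u).trans (Fintype.card_fin h).symm)

/-- The scheme on `h` elements, all of which survive. -/
def allSurvive (h : ℕ) (β : ℝ≥0) : EliminationScheme (Fin h) Unit h 1 β where
  weight := 1
  sum_weight_ne_zero := by
    simp only [Pi.one_apply, sum_const, card_univ, card_powersetCard_eq_choose, Fintype.card_fin,
      Nat.choose_self, one_smul, ne_eq, one_ne_zero, not_false_eq_true]
  list := fun _ _ => []
  enumerates := fun u _ => by
    rw [coe_powersetCard_eq_univ u, compl_univ]
    rfl
  spread := fun A _ => by
    rw [one_pow, one_mul]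
    refine sum_le_sum fun u _ => le_of_eq ?_
    rw [Set.indicator_of_mem]
    exact (subset_univ A).trans_eq (coe_powersetCard_eq_univ u).symm
  hazardLE := fun _ => .of_length_le fun _ => Nat.zero_le _

theorem exists_iterate {L d : ℕ} (ht : 0 < t)
    (hM : (t : ℝ≥0) * 64 ^ h ≤ M * (((1 / 16) ^ L) ^ h) ^ 2) (hd : d ≤ L) :
    ∃ (V Ω : Type) (_ : Fintype V) (_ : DecidableEq V) (_ : Fintype Ω),
      Fintype.card V = 2 ^ d * h ∧ Fintype.card Ω = M ^ d ∧
      Nonempty (EliminationScheme V Ω h ((1 / 16) ^ d)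
        ((h : ℝ≥0)⁻¹ * ((1 + (t : ℝ≥0)⁻¹) ^ 2) ^ d)) := by
  induction d with
  | zero =>
    refine ⟨Fin h, Unit, inferInstance, inferInstance, inferInstance, by simp, by simp, ?_⟩
    rw [pow_zero, pow_zero]
    exact ⟨allSurvive h _⟩
  | succ d ih =>
    obtain ⟨V, Ω, _, _, _, hV, hΩ, ⟨S⟩⟩ := ih (by omega)
    refine ⟨V ⊕ V, Fin M × Ω, inferInstance, inferInstance, inferInstance, ?_, ?_, ?_⟩
    · rw [Fintype.card_sum, hV, pow_succ]
      ring
    · rw [Fintype.card_prod, Fintype.card_fin, hΩ, pow_succ']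
    · rw [pow_succ, pow_succ _ d, ← mul_assoc, mul_one_div]
      refine S.nonempty_merge (by positivity) (le_mul_of_one_le_right zero_le ?_) ht
        (hM.trans ?_)
      · exact one_le_pow₀ (one_le_pow₀ (le_add_of_nonneg_right zero_le))
      · have hpow : ((1 / 16 : ℝ≥0)) ^ L ≤ (1 / 16) ^ d :=
          pow_le_pow_of_le_one zero_le (div_le_one_of_le₀ (by norm_num) zero_le) (by omega)
        gcongr

/-- The survivors are determined by one of `M` equally likely values, up to rounding their
probabilities to multiples of `1 / M`. -/
theorem exists_listFamily {V Ω : Type} [Fintype V] [DecidableEq V] [Fintype Ω] [Nonempty Ω]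
    (S : EliminationScheme V Ω h q β) (ht : 0 < t) (hM : t ≤ M * q ^ h) :
    ∃ P : ListFamily V (Fintype.card V - h),
      (∀ k, HazardLE 1 P.list k (β * (1 + (t : ℝ≥0)⁻¹) ^ 2)) ∧
      Fintype.card P.Ω = M * Fintype.card Ω := by
  have hM0 : 0 < M := Nat.pos_of_ne_zero fun hM0 => by simp [hM0, ht.ne'] at hM
  obtain ⟨f, hf⟩ := exists_withinFactor_pushforward (M := M) S.sum_weight_ne_zero ht fun u => by
    calc (t : ℝ≥0) * ∑ v, S.weight v ≤ M * q ^ h * ∑ v, S.weight v := by gcongr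
      _ ≤ M * S.weight u := by
          rw [mul_assoc]
          gcongr
          exact S.pow_mul_sum_weight_le u
  have : Nonempty (Fin M) := ⟨0, hM0⟩
  refine ⟨{ Ω := Unit × Fin M × Ω, list := fun p => S.list (f p.2.1) p.2.2
            nodup := fun p => (S.enumerates _ _).nodup
            length_eq := fun p => S.length_list _ _ }, fun k => ?_, by simp⟩
  have hone : (1 : Unit × Fin M × Ω → ℝ≥0) = (∑ u, S.weight u)⁻¹ • fun _ => ∑ u, S.weight u :=
    funext fun _ => (inv_mul_cancel₀ S.sum_weight_ne_zero).symm
  rw [hone]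
  exact ((S.hazardLE k).coupling (μ := fun _ : Unit => ∑ u, S.weight u) (f := fun _ => f)
    (g := fun _ => ()) (fun _ _ => rfl) hf).smul

end EliminationScheme

section PrefixFamily

variable {V W : Type*} {ℓ : ℕ}

/-- The image of a family of lists under an embedding. -/
def ListFamily.map (P : ListFamily V ℓ) (e : V ↪ W) : ListFamily W ℓ where
  Ω := P.Ω
  list := fun ω => (P.list ω).map e
  nodup := fun ω => (P.nodup ω).map e.injective
  length_eq := fun ω => by rw [List.length_map, P.length_eq]

theorem one_add_inv_two_mul_pow_le_four (L : ℕ) :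
    (1 + ((2 * (L + 1) : ℕ) : ℝ≥0)⁻¹) ^ (2 * (L + 1)) ≤ 4 := by
  have ht : ((2 * (L + 1) : ℕ) : ℝ) ≠ 0 := by positivity
  rw [← NNReal.coe_le_coe]
  push_cast [NNReal.coe_pow, NNReal.coe_add, NNReal.coe_inv, NNReal.coe_natCast]
  calc (1 + (2 * (L + 1) : ℝ)⁻¹) ^ (2 * (L + 1))
      ≤ Real.exp (2 * (L + 1) : ℝ)⁻¹ ^ (2 * (L + 1)) := by
        gcongr
        rw [add_comm]
        exact Real.add_one_le_exp _
    _ = Real.exp 1 := by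
        push_cast at ht
        rw [← Real.exp_nat_mul]
        push_cast
        rw [mul_inv_cancel₀ ht]
    _ ≤ 4 := by linarith [Real.exp_one_lt_d9]

theorem two_mul_pow_le_two_pow {h : ℕ} (hh : 0 < h) (L : ℕ) :
    2 * (L + 1) * 64 ^ h * ((16 ^ L) ^ h) ^ 2 ≤ 2 ^ (9 * h * (L + 1)) := by
  have hL : 2 * (L + 1) ≤ 2 ^ (L + 1) := by
    rw [pow_succ']
    exact Nat.mul_le_mul_left 2 Nat.lt_two_pow_self
  calc 2 * (L + 1) * 64 ^ h * ((16 ^ L) ^ h) ^ 2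
      ≤ 2 ^ (L + 1) * (2 ^ 6) ^ h * (((2 ^ 4) ^ L) ^ h) ^ 2 := by gcongr <;> norm_num
    _ = 2 ^ (L + 1 + 6 * h + 4 * L * h * 2) := by
        rw [pow_add _ (_ + _), pow_add _ (L + 1)]
        simp only [pow_mul]
    _ ≤ 2 ^ (9 * h * (L + 1)) := by
        refine Nat.pow_le_pow_right two_pos ?_
        nlinarith [Nat.zero_le L]

/-- The hazard of `L` mergings and of the final choice of the survivors is at most `4 / h` if all
these roundings are made to within `1 / (2 * (L + 1))`. -/
theorem exists_prefixFamily {n h L : ℕ} (hh : 0 < h) (hn : 2 ^ L * h ≤ n) :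
    ∃ P : ListFamily (Fin n) (2 ^ L * h - h), (∀ k, HazardLE 1 P.list k (4 / h)) ∧
      Fintype.card P.Ω ≤ 2 ^ (9 * h * (L + 1) ^ 2) := by
  set t := 2 * (L + 1) with ht
  set M := t * 64 ^ h * ((16 ^ L) ^ h) ^ 2 with hM
  have hMq : (t : ℝ≥0) * 64 ^ h = M * (((1 / 16) ^ L) ^ h) ^ 2 := by
    rw [hM]
    push_cast
    rw [mul_assoc _ _ ((((1 / 16 : ℝ≥0) ^ L) ^ h) ^ 2), ← mul_pow, ← mul_pow, ← mul_pow]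
    norm_num
  have hMt : (t : ℝ≥0) ≤ M * ((1 / 16) ^ L) ^ h := by
    calc (t : ℝ≥0) ≤ t * 64 ^ h := le_mul_of_one_le_right zero_le (one_le_pow₀ (by norm_num))
      _ = M * (((1 / 16) ^ L) ^ h) ^ 2 := hMq
      _ ≤ M * ((1 / 16) ^ L) ^ h := by
          refine mul_le_mul_right (pow_le_of_le_one zero_le ?_ two_ne_zero) _
          exact pow_le_one₀ zero_le
            (pow_le_one₀ zero_le (div_le_one_of_le₀ (by norm_num) zero_le))
  have ht0 : 0 < t := by omega
  have hM0 : 0 < M := by positivity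
  obtain ⟨V, Ω, _, _, _, hV, hΩ, ⟨S⟩⟩ := EliminationScheme.exists_iterate ht0 hMq.le le_rfl
  have : Nonempty Ω := Fintype.card_pos_iff.1 (hΩ ▸ pow_pos hM0 L)
  obtain ⟨P, hP, hcard⟩ := S.exists_listFamily ht0 hMt
  obtain ⟨e⟩ : Nonempty (V ↪ Fin n) :=
    Function.Embedding.nonempty_of_card_le (by rwa [hV, Fintype.card_fin])
  rw [← hV]
  refine ⟨P.map e, fun k => ((hP k).mono ?_).map e, ?_⟩
  · rw [mul_assoc, ← pow_succ, ← pow_mul, ← ht, div_eq_inv_mul]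
    gcongr
    exact one_add_inv_two_mul_pow_le_four L
  · calc Fintype.card P.Ω = M ^ (L + 1) := by rw [hcard, hΩ, pow_succ']
      _ ≤ (2 ^ (9 * h * (L + 1))) ^ (L + 1) := by
          gcongr
          exact two_mul_pow_le_two_pow hh L
      _ = 2 ^ (9 * h * (L + 1) ^ 2) := by rw [← pow_mul, mul_assoc (9 * h), ← sq]

end PrefixFamily

theorem exists_disjoint_translates {Ω V : Type*} [Fintype Ω] [Nonempty Ω] [Fintype V]
    {l : Ω → List V} (hl : ∀ ω, Enumerates (l ω) univ) {M : ℕ}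
    (hM : M * Fintype.card Ω ^ 2 ≤ (Fintype.card V).factorial) :
    ∃ ρ : Fin M → Equiv.Perm V,
      ∀ s s' ω ω', (l ω).map (ρ s) = (l ω').map (ρ s') → s = s' := by
  classical
  induction M with
  | zero => exact ⟨Fin.elim0, fun s => s.elim0⟩
  | succ M ih =>
    obtain ⟨ρ, hρ⟩ := ih ((Nat.mul_le_mul_right _ (Nat.le_succ M)).trans hM)
    obtain ⟨σ, hσ⟩ : ∃ σ : Equiv.Perm V, ∀ s ω ω', (l ω).map σ ≠ (l ω').map (ρ s) := by
      by_contra! hbad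
      choose s ω ω' hs using hbad
      have hinj : Function.Injective fun σ => (s σ, ω σ, ω' σ) := by
        intro σ τ hστ
        simp only [Prod.mk.injEq] at hστ
        have hmap : (l (ω σ)).map σ = (l (ω σ)).map τ := by
          rw [hs σ, hστ.1, hστ.2.2, hστ.2.1, hs τ]
        exact Equiv.ext fun x => List.map_inj_left.1 hmap x ((hl _).mem_iff.2 (mem_univ x))
      have hcard := Fintype.card_le_of_injective _ hinj
      rw [Fintype.card_perm, Fintype.card_prod, Fintype.card_prod, Fintype.card_fin, ← sq] at hcard
      have hpos : 0 < Fintype.card Ω ^ 2 := pow_pos Fintype.card_pos 2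
      exact absurd (hM.trans hcard)
        (not_le.2 ((Nat.mul_lt_mul_right hpos).2 (Nat.lt_succ_self M)))
    refine ⟨Fin.cons σ ρ, fun s s' ω ω' h => ?_⟩
    cases s using Fin.cases with
    | zero =>
      cases s' using Fin.cases with
      | zero => rfl
      | succ s' => exact absurd h (hσ s' ω ω')
    | succ s =>
      cases s' using Fin.cases with
      | zero => exact absurd h.symm (hσ s ω' ω)
      | succ s' => exact congrArg Fin.succ (hρ _ _ _ _ h)

namespace ListFamily

variable {V : Type*} {ℓ n' : ℕ}

/-- The set of the elements of a list of the family. -/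
def support (P : ListFamily V ℓ) (s : P.Ω) : Set.powersetCard V ℓ :=
  ⟨⟨(P.list s : Multiset V), Multiset.coe_nodup.2 (P.nodup s)⟩, P.length_eq s⟩

theorem enumerates_support (P : ListFamily V ℓ) (s : P.Ω) : Enumerates (P.list s) (P.support s) :=
  rfl

variable [Fintype V] [DecidableEq V]

/-- Continue each list `s` of `P` by the lists of `F`, with their entries replaced, after the
permutation `ρ s`, by the elements that are missing from `s`. -/
noncomputable def extendList (P : ListFamily V ℓ) (F : ListFamily (Fin n') n')
    (hV : n' + ℓ = Fintype.card V) (ρ : P.Ω → Equiv.Perm (Fin n')) (p : P.Ω × F.Ω) : List V :=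
  P.list p.1 ++ ((F.list p.2).map (ρ p.1).toEmbedding).map
    (enum (Set.powersetCard.compl hV (P.support p.1)))

variable {P : ListFamily V ℓ} {F : ListFamily (Fin n') n'} {hV : n' + ℓ = Fintype.card V}
  {ρ : P.Ω → Equiv.Perm (Fin n')} {k : ℕ} {β : ℝ≥0}

theorem length_extendList (p : P.Ω × F.Ω) : (P.extendList F hV ρ p).length = ℓ + n' := by
  rw [extendList, List.length_append, List.length_map, List.length_map, P.length_eq, F.length_eq]

theorem nodup_extendList (p : P.Ω × F.Ω) : (P.extendList F hV ρ p).Nodup := by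
  have hF := (F.enumerates_univ (Fintype.card_fin n') p.2).map (ρ p.1).toEmbedding
  rw [map_univ_equiv] at hF
  exact ((P.enumerates_support p.1).append_disjUnion (hF.map_enum _) disjoint_compl_right).nodup

theorem extendList_injective (hF : Function.Injective F.list)
    (hρ : ∀ s s' ω ω', (F.list ω).map (ρ s) = (F.list ω').map (ρ s') → s = s') :
    Function.Injective (P.extendList F hV ρ) := by
  rintro ⟨s, ω⟩ ⟨s', ω'⟩ h
  obtain ⟨hprefix, hrest⟩ := List.append_inj h ((P.length_eq s).trans (P.length_eq s').symm)
  have hsupport : P.support s = P.support s' :=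
    Subtype.ext (val_injective (congrArg Multiset.ofList hprefix))
  dsimp only at hrest
  rw [hsupport] at hrest
  have hlist := (enum _).injective.list_map hrest
  obtain rfl := hρ _ _ _ _ hlist
  rw [hF ((ρ s).injective.list_map hlist)]

theorem hazardLE_extendList_left (h : HazardLE 1 P.list k β) (hk : k < ℓ) :
    HazardLE 1 (P.extendList F hV ρ) k β :=
  .of_fibers (Equiv.prodComm F.Ω P.Ω) fun _ =>
    HazardLE.append_left h fun s => hk.trans_eq (P.length_eq s).symm

theorem hazardLE_extendList_right (h : HazardLE 1 F.list (k - ℓ) β) (hk : ℓ ≤ k) :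
    HazardLE 1 (P.extendList F hV ρ) k β := by
  refine .of_fibers (Equiv.refl (P.Ω × F.Ω)) fun s => ?_
  have hcard : #(P.support s : Finset V) = ℓ := Set.powersetCard.card_eq (P.support s)
  have hF : HazardLE 1 F.list (k - #(P.support s : Finset V)) β := by rwa [hcard]
  exact ((hF.map (ρ s).toEmbedding).map
    (enum (Set.powersetCard.compl hV (P.support s)))).append_right
    (fun _ => P.enumerates_support s) (hcard.trans_le hk)

end ListFamily

/-- There are at most `N` distinct orderings of `Fin n` of which a uniformly random one has, given
the set of its first `k` entries, no next entry of probability more than `α / (n - k)`, for each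
`k < n`. -/
def HasUniformFamily (α : ℝ≥0) (n : ℕ) (N : ℝ) : Prop :=
  ∃ F : ListFamily (Fin n) n, Function.Injective F.list ∧
    (∀ k < n, HazardLE 1 F.list k (α / (n - k : ℕ))) ∧ Fintype.card F.Ω ≤ N

theorem HasBalancedFamily.hasUniformFamily {α : ℝ≥0} {n N : ℕ} (h : HasBalancedFamily n N)
    (hα : 1 ≤ α) : HasUniformFamily α n N := by
  obtain ⟨F, hinj, hbal, hcard⟩ := h
  refine ⟨F, hinj, fun k _ => ?_, Nat.cast_le.2 hcard⟩
  obtain ⟨c, hc⟩ := hbal k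
  refine (hc.hazardLE F.nodup).mono ?_
  rw [Fintype.card_fin, ← one_div]
  gcongr

namespace HasUniformFamily

variable {α : ℝ≥0} {n n' ℓ : ℕ} {N N' : ℝ}

theorem mono (h : HasUniformFamily α n N) (hN : N ≤ N') : HasUniformFamily α n N' :=
  let ⟨F, hinj, hhaz, hcard⟩ := h
  ⟨F, hinj, hhaz, hcard.trans hN⟩

theorem of_le (h : n ≤ α) : HasUniformFamily α n 1 := by
  refine ⟨{ Ω := Unit, list := fun _ => List.finRange n
            nodup := fun _ => List.nodup_finRange n
            length_eq := fun _ => List.length_finRange }, fun _ _ _ => rfl, fun k hk => ?_,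
    by simp⟩
  have hpos : (0 : ℝ≥0) < (n - k : ℕ) := Nat.cast_pos.2 (Nat.sub_pos_of_lt hk)
  exact .of_one_le ((one_le_div hpos).2 ((Nat.cast_le.2 (Nat.sub_le n k)).trans h))

theorem extend (h : HasUniformFamily α n' N) (hn : ℓ + n' = n) {P : ListFamily (Fin n) ℓ}
    (hP : ∀ k, HazardLE 1 P.list k (α / n))
    (hfac : Fintype.card P.Ω * N ^ 2 ≤ n'.factorial) :
    HasUniformFamily α n (Fintype.card P.Ω * N) := by
  subst hn
  obtain ⟨F, hinj, hhaz, hcard⟩ := h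
  obtain ⟨ρ, hρ⟩ := exists_disjoint_translates (F.enumerates_univ (Fintype.card_fin n'))
    (M := Fintype.card P.Ω) (by
      rw [Fintype.card_fin, ← Nat.cast_le (α := ℝ)]
      push_cast
      exact le_trans (by gcongr) hfac)
  let e := Fintype.equivFin P.Ω
  refine ⟨{ Ω := P.Ω × F.Ω, list := P.extendList F (by rw [Fintype.card_fin, add_comm]) (ρ ∘ e)
            nodup := ListFamily.nodup_extendList
            length_eq := ListFamily.length_extendList },
    ListFamily.extendList_injective hinj fun s s' ω ω' h => e.injective (hρ _ _ ω ω' h),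
    fun k hk => ?_, ?_⟩
  · rcases lt_or_ge k ℓ with hkℓ | hkℓ
    · refine ListFamily.hazardLE_extendList_left ((hP k).mono ?_) hkℓ
      have hpos : (0 : ℝ≥0) < (ℓ + n' - k : ℕ) := Nat.cast_pos.2 (Nat.sub_pos_of_lt hk)
      gcongr
      exact Nat.sub_le _ k
    · refine ListFamily.hazardLE_extendList_right ?_ hkℓ
      have hsub : ℓ + n' - k = n' - (k - ℓ) := by omega
      rw [hsub]
      exact hhaz _ (by omega)
  · rw [Fintype.card_prod, Nat.cast_mul]
    gcongr

end HasUniformFamily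

section Scales

variable {α : ℝ} {n : ℕ}

theorem exp_two_mul_le_factorial (hn : 27 ≤ n) : Real.exp (2 * n) ≤ n.factorial := by
  have hexp : Real.exp 3 ≤ n := by
    calc Real.exp 3 = Real.exp 1 ^ 3 := by rw [← Real.exp_nat_mul]; norm_num
      _ ≤ 3 ^ 3 := by gcongr; exact Real.exp_one_lt_three.le
      _ ≤ n := by norm_num; exact_mod_cast hn
  have hpow := Real.pow_div_factorial_le_exp (n : ℝ) n.cast_nonneg n
  rw [div_le_iff₀ (by positivity)] at hpow
  refine le_of_mul_le_mul_left ?_ (Real.exp_pos n)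
  calc Real.exp n * Real.exp (2 * n) = Real.exp 3 ^ n := by
        rw [← Real.exp_add, ← Real.exp_nat_mul]
        ring_nf
    _ ≤ (n : ℝ) ^ n := by gcongr
    _ ≤ Real.exp n * n.factorial := hpow

theorem exists_two_pow_mul_le {h : ℕ} (hh : 0 < h) (hn : 2 * h ≤ n) :
    ∃ L, 2 * (2 ^ L * h) ≤ n ∧ n < 4 * (2 ^ L * h) := by
  have hne : n / (2 * h) ≠ 0 := (Nat.div_pos hn (by omega)).ne'
  refine ⟨Nat.log 2 (n / (2 * h)), ?_, ?_⟩
  · have hle := Nat.pow_log_le_self 2 hne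
    rw [Nat.le_div_iff_mul_le (by omega)] at hle
    linarith
  · have hlt := Nat.lt_pow_succ_log_self one_lt_two (n / (2 * h))
    rw [Nat.div_lt_iff_lt_mul (by omega), pow_succ] at hlt
    linarith

theorem add_one_sq_le_of_two_pow_le {L : ℕ} (h : 2 ^ L ≤ α) :
    ((L : ℝ) + 1) ^ 2 ≤ 8 * (1 + Real.log α ^ 2) := by
  have hlog : (L : ℝ) * Real.log 2 ≤ Real.log α := by
    rw [← Real.log_pow]
    exact Real.log_le_log (by positivity) h
  have hL : (L : ℝ) ≤ 2 * Real.log α := by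
    nlinarith [Real.log_two_gt_d9, L.cast_nonneg (α := ℝ)]
  nlinarith [sq_nonneg (2 * Real.log α - 1), L.cast_nonneg (α := ℝ)]

theorem exists_scale (hα : 64 ≤ α) (hn : α < n) :
    ∃ h L : ℕ, 0 < h ∧ 4 * (n / α) ≤ h ∧ (h : ℝ) ≤ 5 * (n / α) ∧ 8 * h ≤ n ∧
      2 * (2 ^ L * h) ≤ n ∧ n < 4 * (2 ^ L * h) ∧ 2 ^ L ≤ α := by
  have hα0 : 0 < α := by linarith
  have hone : 1 < n / α := (one_lt_div hα0).2 hn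
  have hlo := Nat.le_ceil (4 * (n / α))
  have hup : (⌈4 * (n / α)⌉₊ : ℝ) ≤ 5 * (n / α) := by
    linarith [Nat.ceil_lt_add_one (show 0 ≤ 4 * (n / α) by positivity)]
  set h := ⌈4 * (n / α)⌉₊
  have hh : 0 < h := Nat.cast_pos.1 (by linarith : (0 : ℝ) < h)
  have hn64 : 64 * (n / α) ≤ n := by
    calc 64 * (n / α) ≤ α * (n / α) := by gcongr
      _ = n := mul_div_cancel₀ _ hα0.ne'
  have h8 : 8 * h ≤ n := by
    have : (8 * h : ℝ) ≤ n := by linarith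
    exact_mod_cast this
  obtain ⟨L, hL, hL'⟩ := exists_two_pow_mul_le hh (n := n) (by omega)
  refine ⟨h, L, hh, hlo, hup, h8, hL, hL', ?_⟩
  refine le_of_mul_le_mul_right ?_ (show 0 < n / α by linarith)
  calc 2 ^ L * (n / α) ≤ 2 ^ L * h := by gcongr; linarith
    _ ≤ n := by
        have : 2 ^ L * h ≤ n := by omega
        exact_mod_cast this
    _ = α * (n / α) := (mul_div_cancel₀ _ hα0.ne').symm

theorem eventually_mul_one_add_log_sq_le (c : ℝ) :
    ∀ᶠ α in Filter.atTop, c * (1 + Real.log α ^ 2) ≤ α := by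
  have hc : 0 < 2 * (|c| + 1) := by positivity
  filter_upwards [(Real.isLittleO_pow_log_id_atTop (n := 2)).def (inv_pos.2 hc),
    Filter.eventually_ge_atTop (2 * (|c| + 1))] with α hlog hα
  rw [Real.norm_of_nonneg (sq_nonneg _), id, Real.norm_of_nonneg (by linarith),
    ← div_eq_inv_mul, le_div_iff₀ hc] at hlog
  nlinarith [le_abs_self c, abs_nonneg c, sq_nonneg (Real.log α)]

end Scales

section Existence

variable {α : ℝ≥0} {n : ℕ}

theorem exists_prefixFamily_of_lt (hα : 64 ≤ α) (hn : α < n) :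
    ∃ ℓ n', ℓ + n' = n ∧ 8 * n' ≤ 7 * n ∧ n ≤ 2 * n' ∧ ∃ P : ListFamily (Fin n) ℓ,
      (∀ k, HazardLE 1 P.list k (α / n)) ∧
      Fintype.card P.Ω ≤ Real.exp (360 * (n / α * (1 + Real.log α ^ 2))) := by
  obtain ⟨h, L, hh, hlo, hup, h8, hL, hL', hLα⟩ :=
    exists_scale (α := α) (n := n) (by exact_mod_cast hα) (by exact_mod_cast hn)
  have hle : h ≤ 2 ^ L * h := Nat.le_mul_of_pos_left _ (by positivity)
  obtain ⟨P, hP, hcard⟩ := exists_prefixFamily (n := n) (L := L) hh (by omega)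
  refine ⟨2 ^ L * h - h, n - (2 ^ L * h - h), by omega, by omega, by omega, P,
    fun k => (hP k).mono ?_, ?_⟩
  · have hn0 : (0 : ℝ≥0) < n := zero_le.trans_lt hn
    have hlo' : 4 * (n / α) ≤ (h : ℝ≥0) := by exact_mod_cast hlo
    rw [div_le_div_iff₀ (Nat.cast_pos.2 hh) hn0]
    calc 4 * (n : ℝ≥0) = α * (4 * (n / α)) := by
          rw [mul_left_comm, mul_div_cancel₀]
          exact (zero_lt_one.trans_le ((by norm_num : (1 : ℝ≥0) ≤ 64).trans hα)).ne'
      _ ≤ α * h := by gcongr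
  · calc (Fintype.card P.Ω : ℝ) ≤ 2 ^ (9 * h * (L + 1) ^ 2) := by exact_mod_cast hcard
      _ ≤ Real.exp 1 ^ (9 * h * (L + 1) ^ 2) := by
          gcongr
          linarith [Real.exp_one_gt_d9]
      _ = Real.exp (9 * h * ((L : ℝ) + 1) ^ 2) := by
          rw [← Real.exp_nat_mul, mul_one]
          push_cast
          rfl
      _ ≤ Real.exp (9 * (5 * (n / α)) * (8 * (1 + Real.log α ^ 2))) := by
          gcongr
          exact add_one_sq_le_of_two_pow_le hLα
      _ = Real.exp (360 * (n / α * (1 + Real.log α ^ 2))) := by ring_nf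

theorem hasUniformFamily_of_mul_one_add_log_sq_le (hα : 5400 * (1 + Real.log α ^ 2) ≤ α) (n : ℕ) :
    HasUniformFamily α n (Real.exp (2880 * (n / α * (1 + Real.log α ^ 2)))) := by
  induction n using Nat.strong_induction_on with | _ n ih
  rcases le_or_gt (n : ℝ≥0) α with hn | hn
  · exact (HasUniformFamily.of_le hn).mono (Real.one_le_exp (by positivity))
  have hα64 : (64 : ℝ) ≤ α := by linarith [sq_nonneg (Real.log α)]
  have hαn : (α : ℝ) < n := by exact_mod_cast hn
  obtain ⟨ℓ, n', hℓ, hup, hlo, P, hP, hcard⟩ :=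
    exists_prefixFamily_of_lt (by exact_mod_cast hα64) hn
  have hn64 : 64 < n := by exact_mod_cast hα64.trans_lt hαn
  have hup' : (8 * n' : ℝ) ≤ 7 * n := by exact_mod_cast hup
  set x := (n : ℝ) / α * (1 + Real.log α ^ 2) with hx
  set x' := (n' : ℝ) / α * (1 + Real.log α ^ 2) with hx'
  have hα0 : (0 : ℝ) < α := by linarith
  have hxn : 5400 * x ≤ n := by
    calc 5400 * x = n / α * (5400 * (1 + Real.log α ^ 2)) := by rw [hx]; ring
      _ ≤ n / α * α := by gcongr
      _ = n := div_mul_cancel₀ _ hα0.ne'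
  have hxx' : 8 * x' ≤ 7 * x := by
    rw [hx, hx', ← mul_assoc, ← mul_assoc, ← mul_div_assoc, ← mul_div_assoc]
    gcongr
  refine ((ih n' (by omega)).extend hℓ hP ?_).mono ?_
  · calc Fintype.card P.Ω * Real.exp (2880 * x') ^ 2
        ≤ Real.exp (360 * x) * Real.exp (2880 * x') ^ 2 := by gcongr
      _ = Real.exp (360 * x + 2 * (2880 * x')) := by
          rw [← Real.exp_nat_mul, ← Real.exp_add, Nat.cast_ofNat]
      _ ≤ Real.exp (2 * n') := by
          gcongr
          have hlo' : (n : ℝ) ≤ 2 * n' := by exact_mod_cast hlo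
          linarith
      _ ≤ n'.factorial := exp_two_mul_le_factorial (by omega)
  · calc Fintype.card P.Ω * Real.exp (2880 * x')
        ≤ Real.exp (360 * x) * Real.exp (2880 * x') := by gcongr
      _ = Real.exp (360 * x + 2880 * x') := (Real.exp_add _ _).symm
      _ ≤ Real.exp (2880 * x) := by
          gcongr
          linarith

theorem hasUniformFamily_of_le {α₀ : ℝ} (hα : 1 ≤ α) (hα₀ : α ≤ α₀) (n : ℕ) :
    HasUniformFamily α n (Real.exp (3 * α₀ * (n / α * (1 + Real.log α ^ 2)))) := by
  refine ((hasBalancedFamily n).hasUniformFamily hα).mono ?_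
  have hexp : (16 : ℝ) ≤ Real.exp 3 := by
    calc (16 : ℝ) ≤ 2.7 ^ 3 := by norm_num
      _ ≤ Real.exp 1 ^ 3 := by gcongr; linarith [Real.exp_one_gt_d9]
      _ = Real.exp 3 := by rw [← Real.exp_nat_mul]; norm_num
  have hα0 : (0 : ℝ) < α := by exact_mod_cast zero_lt_one.trans_le hα
  push_cast
  calc (16 : ℝ) ^ n ≤ Real.exp 3 ^ n := by gcongr
    _ = Real.exp (3 * (α * (n / α * 1))) := by
        rw [← Real.exp_nat_mul, mul_one, mul_div_cancel₀ _ hα0.ne', mul_comm]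
    _ ≤ Real.exp (3 * (α₀ * (n / α * (1 + Real.log α ^ 2)))) := by
        gcongr
        · exact hα0.le.trans hα₀
        · exact le_add_of_nonneg_right (sq_nonneg (Real.log α))
    _ = Real.exp (3 * α₀ * (n / α * (1 + Real.log α ^ 2))) := by ring_nf

theorem exists_hasUniformFamily : ∃ C : ℝ, 0 < C ∧ ∀ α : ℝ≥0, 1 ≤ α → ∀ n : ℕ,
    HasUniformFamily α n (Real.exp (C * (n / α * (1 + Real.log α ^ 2)))) := by
  obtain ⟨α₀, hα₀⟩ := Filter.eventually_atTop.1 (eventually_mul_one_add_log_sq_le 5400)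
  refine ⟨max 2880 (3 * α₀), by positivity, fun α hα n => ?_⟩
  rcases le_or_gt α₀ α with h | h
  · refine (hasUniformFamily_of_mul_one_add_log_sq_le (hα₀ α h) n).mono ?_
    gcongr
    exact le_max_left _ _
  · refine (hasUniformFamily_of_le hα h.le n).mono ?_
    gcongr
    exact le_max_right _ _

end Existence

section Permutations

variable {n : ℕ} {l : List (Fin n)} {hl : l.Nodup} {hn : l.length = n}

/-- The permutation of which `l` lists the values from the last to the first. -/
noncomputable def backwardsPerm (l : List (Fin n)) (hl : l.Nodup) (hn : l.length = n) :
    Equiv.Perm (Fin n) :=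
  Equiv.ofBijective (fun i => l.get (i.rev.cast hn.symm)) <| Finite.injective_iff_bijective.1 <|
    (List.nodup_iff_injective_get.1 hl).comp <| (Fin.cast_injective _).comp Fin.rev_injective

theorem getElem?_rev_eq_backwardsPerm (i : Fin n) :
    l[(i.rev : ℕ)]? = some (backwardsPerm l hl hn i) :=
  List.getElem?_eq_getElem _

theorem backwardsPerm_injective {l' : List (Fin n)} {hl' : l'.Nodup} {hn' : l'.length = n}
    (h : backwardsPerm l hl hn = backwardsPerm l' hl' hn') : l = l' := by
  refine List.ext_get (hn.trans hn'.symm) fun i hi _ => ?_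
  have hget := Equiv.congr_fun h (Fin.rev ⟨i, hn ▸ hi⟩)
  simpa only [backwardsPerm, Equiv.ofBijective_apply, Fin.rev_rev, Fin.cast_mk] using hget

theorem disjoint_prefixSet_backwardsPerm {m : ℕ} :
    Disjoint (prefixSet (backwardsPerm l hl hn) m) (l.take (n - m)).toFinset := by
  rw [disjoint_left]
  intro x hx
  obtain ⟨j, hj, rfl⟩ := mem_image.1 hx
  rw [List.mem_toFinset, List.mem_take_iff_getElem]
  rintro ⟨i, hi, hij⟩
  have hrev : i = j.rev := hl.getElem_inj_iff.1 hij
  have hjm : (j : ℕ) < m := (mem_filter.1 hj).2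
  rw [Fin.val_rev] at hrev
  omega

theorem prefixSet_backwardsPerm {m : ℕ} (hm : m ≤ n) :
    prefixSet (backwardsPerm l hl hn) m = (l.take (n - m)).toFinsetᶜ := by
  refine eq_of_subset_of_card_le (le_compl_iff_disjoint_right.2 disjoint_prefixSet_backwardsPerm) ?_
  rw [card_compl, List.toFinset_card_of_nodup (hl.sublist (List.take_sublist _ _)),
    List.length_take, Fintype.card_fin, prefixSet, card_image_of_injective _ (Equiv.injective _),
    Fin.card_filter_val_lt]
  omega

theorem prefixSet_backwardsPerm_eq_iff {Y : Finset (Fin n)} :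
    prefixSet (backwardsPerm l hl hn) #Y = Y ↔ Enumerates (l.take #Yᶜ) Yᶜ := by
  rw [prefixSet_backwardsPerm (card_finset_fin_le Y), compl_eq_comm, eq_comm, card_compl,
    Fintype.card_fin, Enumerates, ← val_inj, List.toFinset_val,
    (hl.sublist (List.take_sublist _ _)).dedup]

theorem backwardsPerm_eq_and_prefixSet_eq_iff {Y : Finset (Fin n)} {x i : Fin n}
    (hi : (i : ℕ) + 1 = #Y) :
    backwardsPerm l hl hn i = x ∧ prefixSet (backwardsPerm l hl hn) #Y = Y ↔ ListsThen l Yᶜ x := by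
  have hrev : (i.rev : ℕ) = #Yᶜ := by rw [Fin.val_rev, card_compl, Fintype.card_fin, hi]
  rw [prefixSet_backwardsPerm_eq_iff, ListsThen, and_comm, ← hrev,
    getElem?_rev_eq_backwardsPerm (hl := hl) (hn := hn), Option.some_inj]

theorem prefixSet_backwardsPerm_eq_iff_listsFirst {Y : Finset (Fin n)} {i : Fin n}
    (hi : (i : ℕ) + 1 = #Y) :
    prefixSet (backwardsPerm l hl hn) #Y = Y ↔ ListsFirst l Yᶜ := by
  simp only [ListsFirst, ← backwardsPerm_eq_and_prefixSet_eq_iff (hl := hl) (hn := hn) hi,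
    exists_and_right, exists_eq', true_and]

theorem condProb_uniformOfFinset_image_le {Ω : Type*} [Fintype Ω]
    {π : Ω → Equiv.Perm (Fin n)} (hπ : Function.Injective π) (hne : (univ.image π).Nonempty)
    {E F : Set (Equiv.Perm (Fin n))} {β : ℝ≥0}
    (h : mass 1 (π ⁻¹' (E ∩ F)) ≤ β * mass 1 (π ⁻¹' F)) :
    condProb (PMF.uniformOfFinset (univ.image π) hne) E F ≤ β := by
  classical
  have hcard (G : Set (Equiv.Perm (Fin n))) :
      (#{σ ∈ univ.image π | σ ∈ G} : ENNReal) = (mass 1 (π ⁻¹' G) : ℝ≥0) := by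
    rw [filter_image, card_image_of_injective _ hπ, mass_one_eq_card]
    simp
  unfold condProb prob
  rw [PMF.toOuterMeasure_uniformOfFinset_apply, PMF.toOuterMeasure_uniformOfFinset_apply, hcard,
    hcard]
  refine ENNReal.div_le_of_le_mul ?_
  rw [← mul_div_assoc]
  refine ENNReal.div_le_div_right ?_ _
  exact_mod_cast h

theorem HasUniformFamily.exists_backwardsUniform {α : ℝ≥0} {N : ℝ} (h : HasUniformFamily α n N) :
    ∃ (X : Finset (Equiv.Perm (Fin n))) (hX : X.Nonempty),
      #X ≤ N ∧ BackwardsUniform (PMF.uniformOfFinset X hX) α := by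
  obtain ⟨F, hinj, hhaz, hcard⟩ := h
  let π (ω : F.Ω) := backwardsPerm (F.list ω) (F.nodup ω) (F.length_eq ω)
  have hπ : Function.Injective π := fun ω ω' hω => hinj (backwardsPerm_injective hω)
  refine ⟨univ.image π, univ_nonempty.image π, ?_, fun Y _ x _ i hi => ?_⟩
  · rwa [card_image_of_injective _ hπ, card_univ]
  have hα : ENNReal.ofReal (α / #Y) = (α / #Y : ℝ≥0) := by
    rw [← ENNReal.ofReal_coe_nnreal, NNReal.coe_div, NNReal.coe_natCast]
  have hY : n - #Yᶜ = #Y := by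
    rw [card_compl, Fintype.card_fin, Nat.sub_sub_self (card_finset_fin_le Y)]
  have hhazY := hhaz #Yᶜ (by omega) Yᶜ rfl x
  rw [hY] at hhazY
  rw [hα]
  refine condProb_uniformOfFinset_image_le hπ _ ?_
  convert hhazY using 3
  · ext ω
    exact backwardsPerm_eq_and_prefixSet_eq_iff hi
  · ext ω
    exact prefixSet_backwardsPerm_eq_iff_listsFirst hi

end Permutations

theorem mainTheorem5 :
    ∃ C : ℝ, 0 < C ∧ ∀ α : ℝ, 1 < α → ∀ n : ℕ,
      ∃ (X : Finset (Equiv.Perm (Fin n))) (hX : X.Nonempty),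
        (X.card : ℝ) ≤ Real.exp (C * ((n : ℝ) / α * (1 + Real.log α ^ 2))) ∧
        BackwardsUniform (PMF.uniformOfFinset X hX) α := by
  obtain ⟨C, hC, hfam⟩ := exists_hasUniformFamily
  refine ⟨C, hC, fun α hα n => ?_⟩
  lift α to ℝ≥0 using zero_le_one.trans hα.le
  exact (hfam α (NNReal.coe_le_coe.1 hα.le) n).exists_backwardsUniform
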